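/- Let $m,s\ge 1$ and $n$ be integers. A $\Pi_m\Sigma_s$ polynomial in the variables $x_1,\dots,x_n$ is a product $f=F_1\cdots F_m$ of clauses, where each clause $F_i=\sum_{j=1}^{r_i}X_{ij}$ is a sum of $r_i$ single variables, $1\le r_i\le s$; it is given by the list of its clauses. Its sum-product expansion is the list of all products $X_{1j_1}\cdots X_{mj_m}$ with $1\le j_i\le r_i$, listed with repetition and without cancellation (so, over $\mathbb Z$, its monomials are exactly those with nonzero coefficient in $f$). A monomial $x_{i_1}^{e_1}\cdots x_{i_k}^{e_k}$ with $i_1<\dots<i_k$ and all $e_l\ge 1$ is a $c$-monomial if $e_1,\dots,e_k<c$. Theorem. There is an $O(cms\sqrt{m+cn})$ time algorithm that tests, for $c>2$, whether a $\Pi_m\Sigma_s$ polynomial has a $c$-monomial in its sum-product expansion. Precisely: there are a single program $P$ for the random access machine described below and an absolute constant $K$ such that for all integers $c>2$, $m,s\ge1$, $n$ and every $\Pi_m\Sigma_s$ polynomial $f$ in $n$ variables, $P$ started on the word list $c,n,m,r_1,F_1,\dots,r_m,F_m$ (each $F_i$ written as the list of the indices, counted from $0$, of its $r_i$ variables) halts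 after at most $K\cdot cms\sqrt{m+cn}$ steps, with output $1$ if $f$ has a $c$-monomial and with output $0$ otherwise, and during the computation no number larger than $K(c+m+s+n)^K$ is produced. The machine has finitely many registers and finitely many arrays of natural numbers, with indirect addressing, all zero at the start except for the array holding the input; its unit-cost instructions are loading a constant, copying a register, addition, truncated subtraction, reading and writing an array cell, doing nothing, and comparing two registers (in conditionals and while loops). -/

import Mathlib

namespace MonomialTesting

/-! ### Products of sums of variables -/

/-- A `Π_m Σ_s` polynomial in the variables `x_0, …, x_{n-1}`, given in its depth-two form
`F_1 ⋯ F_m`: each clause `F_i` is the sum of a list of at least one and at most `s` variables. -/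
structure PiSigma (m s n : ℕ) where
  clause : Fin m → List (Fin n)
  one_le_length : ∀ i, 1 ≤ (clause i).length
  length_le : ∀ i, (clause i).length ≤ s

/-- The monomial `x^d` is a `c`-monomial: every variable that occurs in it has exponent `< c`. -/
def IsCMonomial {n : ℕ} (c : ℕ) (d : Fin n →₀ ℕ) : Prop :=
  ∀ j ∈ d.support, d j < c

namespace PiSigma

variable {m s n : ℕ}

/-- A selection of one term from each clause. -/
abbrev Choice (f : PiSigma m s n) : Type := ∀ i : Fin m, Fin (f.clause i).length

/-- The monomial (as an exponent vector) obtained by multiplying the selected terms.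
When the selection runs over `f.Choice`, these are the monomials of the sum-product expansion. -/
noncomputable def chosenMonomial (f : PiSigma m s n) (φ : f.Choice) : Fin n →₀ ℕ :=
  ∑ i, Finsupp.single ((f.clause i).get (φ i)) 1

/-- The sum-product expansion of `f` contains a `c`-monomial. -/
def HasCMonomial (c : ℕ) (f : PiSigma m s n) : Prop :=
  ∃ φ : f.Choice, IsCMonomial c (f.chosenMonomial φ)

/-- The polynomial over `R` that `f` represents. -/
noncomputable def toPoly (R : Type*) [CommSemiring R] (f : PiSigma m s n) :
    MvPolynomial (Fin n) R :=
  ∏ i, ((f.clause i).map MvPolynomial.X).sum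

/-- The sum-product expansion: over every coefficient ring, the polynomial is the sum of
the monomials given by all selections of one term from each clause. -/
theorem toPoly_eq_sum (R : Type*) [CommSemiring R] (f : PiSigma m s n) :
    f.toPoly R = ∑ φ : f.Choice, MvPolynomial.monomial (f.chosenMonomial φ) (1 : R) := by
  have h : ∀ i, ((f.clause i).map (MvPolynomial.X (R := R))).sum
      = ∑ j : Fin (f.clause i).length, MvPolynomial.X ((f.clause i).get j) := by
    intro i
    rw [← List.sum_ofFn]
    congr 1
    exact (List.ofFn_getElem_eq_map _ _).symm
  unfold toPoly chosenMonomial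
  rw [Finset.prod_congr rfl fun i _ => h i, Finset.prod_univ_sum]
  simp only [Fintype.piFinset_univ]
  refine Finset.sum_congr rfl fun φ _ => ?_
  rw [MvPolynomial.monomial_sum_one]
  rfl

/-- Over the integers there is no cancellation: `f` has a `c`-monomial in its sum-product expansion
if and only if some `c`-monomial has a nonzero coefficient in the polynomial. -/
theorem hasCMonomial_iff_support (c : ℕ) (f : PiSigma m s n) :
    f.HasCMonomial c ↔ ∃ d ∈ (f.toPoly ℤ).support, IsCMonomial c d := by
  classical
  have hco : ∀ d, (f.toPoly ℤ).coeff d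
      = ∑ φ : f.Choice, if f.chosenMonomial φ = d then (1 : ℤ) else 0 := by
    intro d
    rw [toPoly_eq_sum, MvPolynomial.coeff_sum]
    simp only [MvPolynomial.coeff_monomial]
  constructor
  · rintro ⟨φ, hφ⟩
    refine ⟨_, ?_, hφ⟩
    rw [MvPolynomial.mem_support_iff, hco]
    refine ne_of_gt (Finset.sum_pos' (fun ψ _ => ?_) ⟨φ, Finset.mem_univ _, ?_⟩)
    · split_ifs <;> norm_num
    · simp
  · rintro ⟨d, hd, hc⟩
    rw [MvPolynomial.mem_support_iff, hco] at hd
    obtain ⟨φ, -, hφ⟩ := Finset.exists_ne_zero_of_sum_ne_zero hd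
    refine ⟨φ, ?_⟩
    have : f.chosenMonomial φ = d := by
      by_contra hne
      simp [hne] at hφ
    rwa [this]

/-- The input word list `c, n, m, r_1, F_1, …, r_m, F_m`: every clause `F_i` is written as the list
of the indices of its `r_i` variables, preceded by `r_i`. -/
def encode (c : ℕ) (f : PiSigma m s n) : List ℕ :=
  c :: n :: m :: (List.ofFn fun i : Fin m =>
    (f.clause i).length :: (f.clause i).map (fun x : Fin n => (x : ℕ))).flatten

end PiSigma

/-! ### Random access machine

A random access machine with finitely many registers and finitely many arrays of words with
indirect addressing (finitely many, since a program is a finite text that names them by constants;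
interleaving the arrays in one memory costs a constant factor). The only arithmetic is addition and
truncated subtraction. Control flow is structured, which is a restriction of conditional jumps.
Each instruction and each evaluation of a test takes one step. -/

/-- Comparisons of two registers. -/
inductive Test where
  | lt (a b : ℕ)
  | le (a b : ℕ)
  | eq (a b : ℕ)
  | ne (a b : ℕ)

/-- Programs. Registers (`r`, `a`, `b`) and arrays (`A`) are named by natural numbers. -/
inductive Prog where
  /-- do nothing -/
  | skip
  /-- `r := k` -/
  | const (r k : ℕ)
  /-- `r := a` -/
  | move (r a : ℕ)
  /-- `r := a + b` -/
  | add (r a b : ℕ)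
  /-- `r := max (a - b) 0` -/
  | sub (r a b : ℕ)
  /-- `r := A[a]` -/
  | load (r A a : ℕ)
  /-- `A[a] := b` -/
  | store (A a b : ℕ)
  /-- `p; q` -/
  | seq (p q : Prog)
  /-- `if T then p else q` -/
  | cond (T : Test) (p q : Prog)
  /-- `while T do p` -/
  | loop (T : Test) (p : Prog)

/-- A memory configuration: the contents of the registers and of the arrays. -/
structure State where
  reg : ℕ → ℕ
  arr : ℕ → ℕ → ℕ

/-- Write `v` into register `r`. -/
def State.setReg (σ : State) (r v : ℕ) : State :=
  { σ with reg := Function.update σ.reg r v }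

/-- Write `v` into cell `i` of array `A`. -/
def State.setArr (σ : State) (A i v : ℕ) : State :=
  { σ with arr := Function.update σ.arr A (Function.update (σ.arr A) i v) }

/-- The truth value of a test. -/
def Test.Holds (σ : State) : Test → Prop
  | .lt a b => σ.reg a < σ.reg b
  | .le a b => σ.reg a ≤ σ.reg b
  | .eq a b => σ.reg a = σ.reg b
  | .ne a b => σ.reg a ≠ σ.reg b

/-- `Exec W p σ σ' t`: on a machine whose words hold the numbers `0, …, W`, the program `p`, started
in `σ`, halts in `σ'` after exactly `t` steps. A computation that would produce a number larger than
`W` gets stuck. -/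
inductive Exec (W : ℕ) : Prog → State → State → ℕ → Prop where
  | skip (σ : State) : Exec W .skip σ σ 1
  | const (σ : State) (r k : ℕ) (h : k ≤ W) : Exec W (.const r k) σ (σ.setReg r k) 1
  | move (σ : State) (r a : ℕ) : Exec W (.move r a) σ (σ.setReg r (σ.reg a)) 1
  | add (σ : State) (r a b : ℕ) (h : σ.reg a + σ.reg b ≤ W) :
      Exec W (.add r a b) σ (σ.setReg r (σ.reg a + σ.reg b)) 1
  | sub (σ : State) (r a b : ℕ) : Exec W (.sub r a b) σ (σ.setReg r (σ.reg a - σ.reg b)) 1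
  | load (σ : State) (r A a : ℕ) : Exec W (.load r A a) σ (σ.setReg r (σ.arr A (σ.reg a))) 1
  | store (σ : State) (A a b : ℕ) :
      Exec W (.store A a b) σ (σ.setArr A (σ.reg a) (σ.reg b)) 1
  | seq {p q : Prog} {σ σ₁ σ₂ : State} {t₁ t₂ : ℕ} (hp : Exec W p σ σ₁ t₁)
      (hq : Exec W q σ₁ σ₂ t₂) : Exec W (.seq p q) σ σ₂ (t₁ + t₂)
  | condTrue {T : Test} {p q : Prog} {σ σ' : State} {t : ℕ} (h : T.Holds σ)
      (hp : Exec W p σ σ' t) : Exec W (.cond T p q) σ σ' (1 + t)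
  | condFalse {T : Test} {p q : Prog} {σ σ' : State} {t : ℕ} (h : ¬ T.Holds σ)
      (hq : Exec W q σ σ' t) : Exec W (.cond T p q) σ σ' (1 + t)
  | loopDone {T : Test} {p : Prog} {σ : State} (h : ¬ T.Holds σ) : Exec W (.loop T p) σ σ 1
  | loopStep {T : Test} {p : Prog} {σ σ₁ σ₂ : State} {t₁ t₂ : ℕ} (h : T.Holds σ)
      (hp : Exec W p σ σ₁ t₁) (hl : Exec W (.loop T p) σ₁ σ₂ t₂) :
      Exec W (.loop T p) σ σ₂ (1 + t₁ + t₂)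

/-- The machine is deterministic. -/
theorem Exec.deterministic {W : ℕ} {p : Prog} {σ σ₁ σ₂ : State} {t₁ t₂ : ℕ}
    (h₁ : Exec W p σ σ₁ t₁) (h₂ : Exec W p σ σ₂ t₂) : σ₁ = σ₂ ∧ t₁ = t₂ := by
  induction h₁ generalizing σ₂ t₂ with
  | skip | const | move | add | sub | load | store => cases h₂; exact ⟨rfl, rfl⟩
  | seq _ _ ih₁ ih₂ =>
    cases h₂ with
    | seq hp hq =>
      obtain ⟨rfl, rfl⟩ := ih₁ hp
      obtain ⟨rfl, rfl⟩ := ih₂ hq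
      exact ⟨rfl, rfl⟩
  | condTrue h _ ih =>
    cases h₂ with
    | condTrue _ hp => obtain ⟨rfl, rfl⟩ := ih hp; exact ⟨rfl, rfl⟩
    | condFalse h' _ => exact absurd h h'
  | condFalse h _ ih =>
    cases h₂ with
    | condTrue h' _ => exact absurd h' h
    | condFalse _ hp => obtain ⟨rfl, rfl⟩ := ih hp; exact ⟨rfl, rfl⟩
  | loopDone h =>
    cases h₂ with
    | loopDone _ => exact ⟨rfl, rfl⟩
    | loopStep h' _ _ => exact absurd h' h
  | loopStep h _ _ ih₁ ih₂ =>
    cases h₂ with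
    | loopDone h' => exact absurd h h'
    | loopStep _ hp hl =>
      obtain ⟨rfl, rfl⟩ := ih₁ hp
      obtain ⟨rfl, rfl⟩ := ih₂ hl
      exact ⟨rfl, rfl⟩

/-- The initial configuration: the input is in array `0`, everything else is zero. -/
def initState (input : List ℕ) : State where
  reg := fun _ => 0
  arr := fun A i => if A = 0 then input.getD i 0 else 0

end MonomialTesting

/-!
A selection of one variable from each clause in which every variable is selected less than `c` times
is the same thing as a matching of all clauses into `c - 1` copies of the variables
(`PiSigma.hasCMonomial_iff`). The program therefore writes down the bipartite graph of clauses and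
copies, which has at most `(c - 1) * m * s` edges, and decides whether all clauses can be matched,
with `O(√m)` passes over the graph. The number `L` is the least one with `m ≤ L ^ 2`.

The first phase is an auction. Every clause has a level, at first `0`. A free copy has the price `0`,
and a copy that is owned has a price one above the level of its owner. An unmatched clause runs
through its list and takes a copy that is free or has an owner of a lower level, and the displaced
owner continues; at the end of its list a clause rises by one level and starts again, and at level
`L` it gives up. The pointer into the list may move on after every inspection, since prices never
fall (`Prices`), so that every clause reads its list at most `L` times. If all clauses can be matched,
sum up over such a matching: the levels add up to at most the sum of all prices, which exceeds the
sum of the levels of the matched clauses by at most `m`. Hence at most `m / L ≤ L`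
clauses have given up (`Auction.quit_mul_le`), and with more of them the answer is `0`.

In the second phase, each of these at most `L` clauses is the root of one breadth-first search for an
augmenting path (`Search`, `Flip`). A search that fails has found a set of clauses with too few
neighbours (`Search.not_hasMatching`), and the answer is `0`.

Loop-free code is verified by its weakest precondition `wp`, loops by the rule `Reach.loop`, in which
a measure that decreases with every iteration bounds the running time.
-/

namespace MonomialTesting

open Function

/-! ### Verifying programs -/

attribute [simp] Test.Holds

infixr:60 " ;; " => Prog.seq

@[simp] theorem State.setReg_reg (σ : State) (r v r' : ℕ) :
    (σ.setReg r v).reg r' = if r' = r then v else σ.reg r' := by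
  simp [State.setReg, Function.update_apply]

@[simp] theorem State.setReg_arr (σ : State) (r v : ℕ) : (σ.setReg r v).arr = σ.arr := rfl

@[simp] theorem State.setArr_reg (σ : State) (A i v : ℕ) : (σ.setArr A i v).reg = σ.reg := rfl

@[simp] theorem State.setArr_arr (σ : State) (A i v B : ℕ) :
    (σ.setArr A i v).arr B = if B = A then Function.update (σ.arr A) i v else σ.arr B := by
  simp [State.setArr, Function.update_apply]

/-- Total correctness with a time bound: `p`, started in `σ` on a machine with words up to `W`,
halts after at most `T` steps in a state that satisfies `Q`. -/
def Reach (W : ℕ) (p : Prog) (σ : State) (T : ℕ) (Q : State → Prop) : Prop :=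
  ∃ σ' t, Exec W p σ σ' t ∧ t ≤ T ∧ Q σ'

theorem Reach.mono {W : ℕ} {p : Prog} {σ : State} {T T' : ℕ} {Q Q' : State → Prop}
    (h : Reach W p σ T Q) (hT : T ≤ T') (hQ : ∀ σ', Q σ' → Q' σ') : Reach W p σ T' Q' := by
  obtain ⟨σ', t, he, ht, hq⟩ := h
  exact ⟨σ', t, he, ht.trans hT, hQ _ hq⟩

theorem Reach.seq {W : ℕ} {p q : Prog} {σ : State} {T₁ T₂ : ℕ} {Q R : State → Prop}
    (hp : Reach W p σ T₁ R) (hq : ∀ σ₁, R σ₁ → Reach W q σ₁ T₂ Q) :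
    Reach W (p ;; q) σ (T₁ + T₂) Q := by
  obtain ⟨σ₁, t₁, he₁, ht₁, hr⟩ := hp
  obtain ⟨σ₂, t₂, he₂, ht₂, hq⟩ := hq σ₁ hr
  exact ⟨σ₂, t₁ + t₂, .seq he₁ he₂, by omega, hq⟩

theorem Reach.cond {W : ℕ} {T : Test} {p q : Prog} {σ : State} {t : ℕ} {Q : State → Prop}
    (hp : T.Holds σ → Reach W p σ t Q) (hq : ¬ T.Holds σ → Reach W q σ t Q) :
    Reach W (.cond T p q) σ (1 + t) Q := by
  by_cases h : T.Holds σ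
  · obtain ⟨σ', t', he, ht, hQ⟩ := hp h
    exact ⟨σ', 1 + t', .condTrue h he, by omega, hQ⟩
  · obtain ⟨σ', t', he, ht, hQ⟩ := hq h
    exact ⟨σ', 1 + t', .condFalse h he, by omega, hQ⟩

/-- The rule for loops: `I μ` is an invariant whose parameter `μ` decreases with every iteration,
and an iteration takes at most `C` steps. -/
theorem Reach.loop {W : ℕ} {T : Test} {p : Prog} (C : ℕ) (I : ℕ → State → Prop)
    (hstep : ∀ μ σ, I μ σ → T.Holds σ → Reach W p σ C fun σ' => ∃ μ' < μ, I μ' σ')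
    (μ : ℕ) (σ : State) (h : I μ σ) :
    Reach W (.loop T p) σ (μ * (C + 1) + 1) fun σ' => (∃ μ', I μ' σ') ∧ ¬ T.Holds σ' := by
  induction μ using Nat.strong_induction_on generalizing σ with
  | _ μ ih =>
    by_cases hT : T.Holds σ
    · obtain ⟨σ₁, t₁, he₁, ht₁, μ', hμ', hI⟩ := hstep μ σ h hT
      obtain ⟨σ₂, t₂, he₂, ht₂, hQ⟩ := ih μ' hμ' σ₁ hI
      refine ⟨σ₂, _, .loopStep hT he₁ he₂, ?_, hQ⟩
      have : (μ' + 1) * (C + 1) ≤ μ * (C + 1) := Nat.mul_le_mul_right _ hμ'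
      rw [Nat.add_mul] at this
      omega
    · exact ⟨σ, 1, .loopDone hT, by omega, ⟨μ, h⟩, hT⟩

/-- The weakest precondition of a loop-free program; loops are given the precondition `False`. -/
@[simp] def wp (W : ℕ) : Prog → (State → Prop) → State → Prop
  | .skip, Q, σ => Q σ
  | .const r k, Q, σ => k ≤ W ∧ Q (σ.setReg r k)
  | .move r a, Q, σ => Q (σ.setReg r (σ.reg a))
  | .add r a b, Q, σ => σ.reg a + σ.reg b ≤ W ∧ Q (σ.setReg r (σ.reg a + σ.reg b))
  | .sub r a b, Q, σ => Q (σ.setReg r (σ.reg a - σ.reg b))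
  | .load r A a, Q, σ => Q (σ.setReg r (σ.arr A (σ.reg a)))
  | .store A a b, Q, σ => Q (σ.setArr A (σ.reg a) (σ.reg b))
  | .seq p q, Q, σ => wp W p (wp W q Q) σ
  | .cond T p q, Q, σ => (T.Holds σ → wp W p Q σ) ∧ (¬ T.Holds σ → wp W q Q σ)
  | .loop _ _, _, _ => False

/-- The largest number of steps that a loop-free program can take. -/
def cost : Prog → ℕ
  | .seq p q => cost p + cost q
  | .cond _ p q => 1 + max (cost p) (cost q)
  | _ => 1

theorem Reach.of_wp {W : ℕ} {p : Prog} {σ : State} {Q : State → Prop} (h : wp W p Q σ) :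
    Reach W p σ (cost p) Q := by
  induction p generalizing σ Q with
  | skip => exact ⟨_, _, .skip _, le_rfl, h⟩
  | const r k => exact ⟨_, _, .const _ _ _ h.1, le_rfl, h.2⟩
  | move r a => exact ⟨_, _, .move _ _ _, le_rfl, h⟩
  | add r a b => exact ⟨_, _, .add _ _ _ _ h.1, le_rfl, h.2⟩
  | sub r a b => exact ⟨_, _, .sub _ _ _ _, le_rfl, h⟩
  | load r A a => exact ⟨_, _, .load _ _ _ _, le_rfl, h⟩
  | store A a b => exact ⟨_, _, .store _ _ _ _, le_rfl, h⟩
  | seq p q ihp ihq => exact (ihp h).seq fun _ => ihq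
  | cond T p q ihp ihq =>
    exact .cond (fun hT => (ihp (h.1 hT)).mono (le_max_left _ _) fun _ => id)
      (fun hT => (ihq (h.2 hT)).mono (le_max_right _ _) fun _ => id)
  | loop => exact h.elim

section

/-! ### Partial matchings -/

/-- A bipartite graph with left vertices `1, …, m` is given by its adjacency lists, stored one after
the other in `E`; the list of `b` occupies the cells `st b, …, st (b + 1) - 1`. This is the set of
neighbours of `b`. -/
def nbr (st E : ℕ → ℕ) (b : ℕ) : Set ℕ := E '' Set.Ico (st b) (st (b + 1))

theorem mem_nbr {st E : ℕ → ℕ} {b p : ℕ} (h₁ : st b ≤ p) (h₂ : p < st (b + 1)) :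
    E p ∈ nbr st E b := ⟨p, ⟨h₁, h₂⟩, rfl⟩

/-- All left vertices `1, …, m` can be matched. -/
def HasMatching (m : ℕ) (N : ℕ → Set ℕ) : Prop :=
  ∃ g : ℕ → ℕ, (∀ b ∈ Finset.Icc 1 m, g b ∈ N b) ∧ Set.InjOn g (Finset.Icc 1 m)

/-- `own` is a partial matching: `own a` is the left vertex matched to the right vertex `a`,
and `0` if there is none. -/
structure Matching (m : ℕ) (N : ℕ → Set ℕ) (own : ℕ → ℕ) : Prop where
  mem : ∀ a, own a ≠ 0 → own a ≤ m ∧ a ∈ N (own a)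
  inj : ∀ a a', own a ≠ 0 → own a = own a' → a = a'

/-- The left vertex `b` is matched. -/
def Owned (own : ℕ → ℕ) (b : ℕ) : Prop := ∃ a, own a = b

variable {m : ℕ} {N : ℕ → Set ℕ} {own : ℕ → ℕ}

theorem Matching.update (h : Matching m N own) {a b : ℕ} (hb : b ≤ m) (ha : b ≠ 0 → a ∈ N b)
    (hu : b ≠ 0 → ∀ a', own a' = b → a' = a) : Matching m N (update own a b) := by
  obtain ⟨h1, h2⟩ := h
  constructor
  · grind [update_apply]
  · grind [update_apply]

theorem Matching.hasMatching (h : Matching m N own) (hall : ∀ b ∈ Finset.Icc 1 m, Owned own b) :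
    HasMatching m N := by
  choose! g hg using hall
  refine ⟨g, fun b hb => ?_, fun b hb b' hb' hbb => ?_⟩
  · have := (h.mem (g b) (by rw [hg b hb]; grind)).2
    rwa [hg b hb] at this
  · rw [← hg b hb, ← hg b' hb', hbb]

/-! ### The auction -/

/-- The price of a right vertex: `0` if it is free, and one more than the level of its owner
otherwise. -/
def price (lev own : ℕ → ℕ) (a : ℕ) : ℕ := if own a = 0 then 0 else lev (own a) + 1

/-- The price conditions of the auction: no neighbour of `b` is cheaper than the level of `b`, and
the neighbours in front of the pointer of `b` are more expensive. -/
structure Prices (m : ℕ) (st E lev ptr own : ℕ → ℕ) : Prop where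
  le : ∀ b ∈ Finset.Icc 1 m, ∀ a ∈ nbr st E b, lev b ≤ price lev own a
  ptr_mem : ∀ b ∈ Finset.Icc 1 m, st b ≤ ptr b ∧ ptr b ≤ st (b + 1)
  lt : ∀ b ∈ Finset.Icc 1 m, ∀ p, st b ≤ p → p < ptr b → lev b < price lev own (E p)

variable {st E lev ptr : ℕ → ℕ}

/-- Prices only rise when `b` takes a vertex whose price is at most the level of `b`. -/
theorem price_le_price_update {a b : ℕ} (hb : b ≠ 0) (ha : own a = 0 ∨ lev (own a) < lev b)
    (a' : ℕ) :
    price lev own a' ≤ price lev (update own a b) a' := by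
  unfold price
  grind [update_apply]

/-- After taking a vertex, the bidder may move its pointer, since it has raised the price itself. -/
theorem Prices.bid (h : Prices m st E lev ptr own) {b : ℕ} (hb : 1 ≤ b)
    (hp : ptr b < st (b + 1)) (ha : own (E (ptr b)) = 0 ∨ lev (own (E (ptr b))) < lev b) :
    Prices m st E lev (update ptr b (ptr b + 1)) (update own (E (ptr b)) b) := by
  have hle := price_le_price_update (by omega : b ≠ 0) ha
  have hpr : price lev (update own (E (ptr b)) b) (E (ptr b)) = lev b + 1 := by
    simp only [price, update_self, if_neg (by omega : b ≠ 0)]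
  obtain ⟨h1, h2, h3⟩ := h
  refine ⟨fun b' hb' a' ha' => (h1 b' hb' a' ha').trans (hle a'), ?_, ?_⟩
  · grind [update_apply]
  · intro b' hb' p hp1 hp2
    by_cases hbb : b' = b
    · subst hbb
      rw [update_self] at hp2
      rcases Nat.lt_succ_iff_lt_or_eq.mp hp2 with h | rfl
      · exact (h3 b' hb' p hp1 h).trans_le (hle _)
      · omega
    · rw [update_of_ne hbb] at hp2
      exact (h3 b' hb' p hp1 hp2).trans_le (hle _)

theorem Prices.skip (h : Prices m st E lev ptr own) {b : ℕ}
    (hp : ptr b < st (b + 1)) (ha : own (E (ptr b)) ≠ 0) (ha' : lev b ≤ lev (own (E (ptr b)))) :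
    Prices m st E lev (update ptr b (ptr b + 1)) own := by
  obtain ⟨h1, h2, h3⟩ := h
  refine ⟨h1, by grind [update_apply], fun b' hb' p hp1 hp2 => ?_⟩
  by_cases hbb : b' = b
  · subst hbb
    rw [update_self] at hp2
    rcases Nat.lt_succ_iff_lt_or_eq.mp hp2 with h | rfl
    · exact h3 b' hb' p hp1 h
    · simp [price, ha]; omega
  · rw [update_of_ne hbb] at hp2
    exact h3 b' hb' p hp1 hp2

/-- At the end of its list, all neighbours of `b` cost more than the level of `b`, which can rise. -/
theorem Prices.relabel (h : Prices m st E lev ptr own) {b : ℕ} (hb : 1 ≤ b)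
    (hp : st (b + 1) ≤ ptr b) (hu : ¬ Owned own b) :
    Prices m st E (update lev b (lev b + 1)) (update ptr b (st b)) own := by
  have hpr : ∀ a, price (update lev b (lev b + 1)) own a = price lev own a := by
    intro a
    have : own a ≠ b := fun h => hu ⟨a, h⟩
    simp [price, this]
  obtain ⟨h1, h2, h3⟩ := h
  refine ⟨fun b' hb' a ha => ?_, fun b' hb' => ?_, fun b' hb' p hp1 hp2 => ?_⟩
  · rw [hpr]
    by_cases hbb : b' = b
    · subst hbb
      obtain ⟨p, hp', rfl⟩ := ha
      rw [update_self]
      exact h3 b' hb' p hp'.1 (hp'.2.trans_le hp)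
    · rw [update_of_ne hbb]
      exact h1 b' hb' a ha
  · grind [update_apply]
  · rw [hpr]
    grind [update_apply]

/-- The invariant of the auction: the left vertices `1, …, i` have entered, `b` is the one that bids
next, and the list `U` of length `u` contains those that have given up after reaching level `L`. -/
structure Auction (m L : ℕ) (st E lev ptr own U : ℕ → ℕ) (u i b : ℕ) : Prop where
  matching : Matching m (nbr st E) own
  prices : Prices m st E lev ptr own
  one_le : 1 ≤ i
  le_succ : i ≤ m + 1
  own_le : ∀ a, own a ≤ i
  active : i ≤ m → 1 ≤ b ∧ b ≤ i ∧ lev b < L ∧ ¬ Owned own b ∧ ∀ t < u, U t ≠ b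
  fresh : ∀ b', i < b' → b' ≤ m → lev b' = 0
  lev_le : ∀ b' ∈ Finset.Icc 1 m, lev b' ≤ L
  quit : ∀ t < u, 1 ≤ U t ∧ U t ≤ m ∧ U t ≤ i ∧ L ≤ lev (U t) ∧ ¬ Owned own (U t)
  quit_inj : ∀ t < u, ∀ t' < u, U t = U t' → t = t'
  cover : ∀ b' ∈ Finset.Icc 1 m, b' ≤ i → (b' = b ∧ i ≤ m) ∨ Owned own b' ∨ ∃ t < u, U t = b'

variable {L u i b : ℕ} {U : ℕ → ℕ}

theorem Auction.init (hL : 1 ≤ L) (hst : ∀ b ∈ Finset.Icc 1 m, st b ≤ st (b + 1))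
    (hptr : ∀ b ∈ Finset.Icc 1 m, ptr b = st b) :
    Auction m L st E (fun _ => 0) ptr (fun _ => 0) U 0 1 1 where
  matching := ⟨by simp, by simp⟩
  prices := ⟨by simp, by grind, by grind⟩
  one_le := le_rfl
  le_succ := by omega
  own_le := by simp
  active := by simp [Owned]; omega
  fresh := by simp
  lev_le := by simp
  quit := by simp
  quit_inj := by simp
  cover := by grind

theorem Auction.take (h : Auction m L st E lev ptr own U u i b) (hi : i ≤ m)
    (hp : ptr b < st (b + 1)) (ha : own (E (ptr b)) = 0) :
    Auction m L st E lev (update ptr b (ptr b + 1)) (update own (E (ptr b)) b) U u (i + 1) (i + 1)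
    where
  matching := h.matching.update (by have := h.active hi; omega)
    (fun _ => mem_nbr (h.prices.ptr_mem b (by have := h.active hi; grind)).1 hp)
    (fun _ a' ha' => ((h.active hi).2.2.2.1 ⟨a', ha'⟩).elim)
  prices := h.prices.bid (h.active hi).1 hp (.inl ha)
  one_le := by omega
  le_succ := by omega
  own_le := by have := h.active hi; have := h.own_le; grind [update_apply]
  active := by
    obtain ⟨h1, h2, h3, h4, h5⟩ := h.active hi
    have := h.own_le; have := h.quit; have := h.fresh
    unfold Owned at *
    grind [update_apply]
  fresh := by have := h.fresh; grind
  lev_le := h.lev_le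
  quit := by
    obtain ⟨h1, h2, h3, h4, h5⟩ := h.active hi
    have := h.quit
    unfold Owned at *
    grind [update_apply]
  quit_inj := h.quit_inj
  cover := by
    intro b' hb' hle
    by_cases hbi : b' = i + 1
    · grind
    rcases h.cover b' hb' (by omega) with ⟨rfl, -⟩ | ⟨a, rfl⟩ | h
    · exact .inr (.inl ⟨_, update_self ..⟩)
    · refine .inr (.inl ⟨a, update_of_ne ?_ ..⟩)
      grind
    · exact .inr (.inr h)

theorem Auction.displace (h : Auction m L st E lev ptr own U u i b) (hi : i ≤ m)
    (hp : ptr b < st (b + 1)) (ha : own (E (ptr b)) ≠ 0)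
    (hl : lev (own (E (ptr b))) < lev b) :
    Auction m L st E lev (update ptr b (ptr b + 1)) (update own (E (ptr b)) b) U u i
      (own (E (ptr b))) where
  matching := h.matching.update (by have := h.active hi; omega)
    (fun _ => mem_nbr (h.prices.ptr_mem b (by have := h.active hi; grind)).1 hp)
    (fun _ a' ha' => ((h.active hi).2.2.2.1 ⟨a', ha'⟩).elim)
  prices := h.prices.bid (h.active hi).1 hp (.inr hl)
  one_le := h.one_le
  le_succ := h.le_succ
  own_le := by have := h.active hi; have := h.own_le; grind [update_apply]
  active := by
    obtain ⟨h1, h2, h3, h4, h5⟩ := h.active hi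
    have := h.own_le; have := h.quit; have := h.matching.inj
    unfold Owned at *
    grind [update_apply]
  fresh := h.fresh
  lev_le := h.lev_le
  quit := by
    obtain ⟨h1, h2, h3, h4, h5⟩ := h.active hi
    have := h.quit
    unfold Owned at *
    grind [update_apply]
  quit_inj := h.quit_inj
  cover := by
    intro b' hb' hle
    rcases h.cover b' hb' (by omega) with ⟨rfl, -⟩ | ⟨a, rfl⟩ | h
    · exact .inr (.inl ⟨_, update_self ..⟩)
    · by_cases haa : a = E (ptr b)
      · exact .inl ⟨by rw [haa], hi⟩
      · exact .inr (.inl ⟨a, update_of_ne haa ..⟩)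
    · exact .inr (.inr h)

theorem Auction.skip (h : Auction m L st E lev ptr own U u i b)
    (hp : ptr b < st (b + 1)) (ha : own (E (ptr b)) ≠ 0)
    (hl : lev b ≤ lev (own (E (ptr b)))) :
    Auction m L st E lev (update ptr b (ptr b + 1)) own U u i b :=
  { h with prices := h.prices.skip hp ha hl }

theorem Auction.relabel (h : Auction m L st E lev ptr own U u i b) (hi : i ≤ m)
    (hp : st (b + 1) ≤ ptr b) (hl : lev b + 1 < L) :
    Auction m L st E (update lev b (lev b + 1)) (update ptr b (st b)) own U u i b :=
  { h with
    prices := h.prices.relabel (h.active hi).1 hp (h.active hi).2.2.2.1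
    active := by have := h.active; grind [update_apply]
    fresh := by have := h.active hi; have := h.fresh; grind [update_apply]
    lev_le := by have := h.lev_le; grind [update_apply]
    quit := by have := h.active hi; have := h.quit; grind [update_apply] }

theorem Auction.giveUp (h : Auction m L st E lev ptr own U u i b) (hi : i ≤ m)
    (hp : st (b + 1) ≤ ptr b) (hl : L ≤ lev b + 1) :
    Auction m L st E (update lev b (lev b + 1)) (update ptr b (st b)) own (update U u b) (u + 1)
      (i + 1) (i + 1) where
  matching := h.matching
  prices := h.prices.relabel (h.active hi).1 hp (h.active hi).2.2.2.1
  one_le := by omega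
  le_succ := by omega
  own_le := by have := h.own_le; grind
  active := by
    obtain ⟨h1, h2, h3, h4, h5⟩ := h.active hi
    have := h.own_le; have := h.quit; have := h.fresh
    unfold Owned at *
    grind [update_apply]
  fresh := by have := h.active hi; have := h.fresh; grind [update_apply]
  lev_le := by have := h.active hi; have := h.lev_le; grind [update_apply]
  quit := by have := h.active hi; have := h.quit; grind [update_apply]
  quit_inj := by have := h.active hi; have := h.quit_inj; grind [update_apply]
  cover := by
    intro b' hb' hle
    by_cases hbi : b' = i + 1
    · grind
    rcases h.cover b' hb' (by omega) with ⟨rfl, -⟩ | h | ⟨t, ht, h⟩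
    · exact .inr (.inr ⟨u, by omega, update_self ..⟩)
    · exact .inr (.inl h)
    · exact .inr (.inr ⟨t, by omega, by rwa [update_of_ne (by omega)]⟩)

theorem Auction.quit_le (h : Auction m L st E lev ptr own U u i b) : u ≤ m := by
  have := Finset.card_le_card_of_injOn (s := Finset.range u) (t := Finset.Icc 1 m) U
    (fun t ht => by have := h.quit t (by simpa using ht); simp; omega)
    (fun t ht t' ht' => h.quit_inj t (by simpa using ht) t' (by simpa using ht'))
  simpa using this

/-- The number of quitters is small if a matching exists: the neighbours in a matching of all left
vertices cost together at least as much as the levels add up to, while the sum of all prices exceeds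
the sum of the levels of the matched left vertices by the number of these. -/
theorem Auction.quit_mul_le (h : Auction m L st E lev ptr own U u i b)
    (hM : HasMatching m (nbr st E)) : u * L ≤ m := by
  classical
  obtain ⟨g, hg, hgi⟩ := hM
  set B := Finset.Icc 1 m
  set O := B.filter fun b => Owned own b
  set X := B.filter fun b => ¬ Owned own b
  -- Compare the levels with the prices along the matching `g`.
  have hlow : ∑ b ∈ B, lev b ≤ ∑ b ∈ B, price lev own (g b) :=
    Finset.sum_le_sum fun b hb => h.prices.le b hb _ (hg b hb)
  have hup : ∑ b ∈ B, price lev own (g b) ≤ ∑ b ∈ O, (lev b + 1) := by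
    rw [← Finset.sum_filter_add_sum_filter_not B (fun b => own (g b) ≠ 0)]
    have h0 : ∑ b ∈ B with ¬ own (g b) ≠ 0, price lev own (g b) = 0 :=
      Finset.sum_eq_zero fun b hb => by simp at hb; simp [price, hb.2]
    rw [h0, add_zero]
    have h1 : ∑ b ∈ B with own (g b) ≠ 0, price lev own (g b)
        = ∑ b ∈ B with own (g b) ≠ 0, (lev (own (g b)) + 1) :=
      Finset.sum_congr rfl fun b hb => by
        simp only [Finset.mem_filter] at hb; simp only [price, if_neg hb.2]
    rw [h1, ← Finset.sum_image (f := fun b => lev b + 1) (g := fun b => own (g b))]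
    · refine Finset.sum_le_sum_of_subset fun b' hb' => ?_
      obtain ⟨b, hb, rfl⟩ := Finset.mem_image.1 hb'
      simp only [Finset.mem_filter] at hb
      have := (h.matching.mem _ hb.2).1
      simp only [O, B, Finset.mem_filter, Finset.mem_Icc]
      exact ⟨⟨by omega, this⟩, _, rfl⟩
    · intro b hb b' hb' hbb
      simp only [Finset.coe_filter, Set.mem_ofPred_eq] at hb hb'
      exact hgi hb.1 hb'.1 (h.matching.inj _ _ hb.2 hbb)
  have hsplit : ∑ b ∈ B, lev b = ∑ b ∈ O, lev b + ∑ b ∈ X, lev b :=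
    (Finset.sum_filter_add_sum_filter_not B _ _).symm
  have hX : u * L ≤ ∑ b ∈ X, lev b := by
    have himg : (Finset.range u).image U ⊆ X := by
      intro b' hb'
      obtain ⟨t, ht, rfl⟩ := Finset.mem_image.1 hb'
      have := h.quit t (Finset.mem_range.1 ht)
      simp only [X, B, Finset.mem_filter, Finset.mem_Icc]
      exact ⟨⟨this.1, this.2.1⟩, this.2.2.2.2⟩
    calc u * L = ∑ _t ∈ Finset.range u, L := by simp
      _ ≤ ∑ t ∈ Finset.range u, lev (U t) :=
        Finset.sum_le_sum fun t ht => (h.quit t (Finset.mem_range.1 ht)).2.2.2.1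
      _ = ∑ b ∈ (Finset.range u).image U, lev b := by
        rw [Finset.sum_image]
        intro t ht t' ht' htt
        exact h.quit_inj t (by simpa using ht) t' (by simpa using ht') htt
      _ ≤ _ := Finset.sum_le_sum_of_subset himg
  have hO : ∑ b ∈ O, (lev b + 1) ≤ ∑ b ∈ O, lev b + m := by
    rw [Finset.sum_add_distrib]
    have : O.card ≤ B.card := Finset.card_filter_le _ _
    simp [B] at this ⊢
    omega
  omega

end

section

/-! ### Searching for an augmenting path -/

/-- A tree of alternating paths from the unmatched vertex `r`: its left vertices are
`Q 0 = r, Q 1, …, Q (tl - 1)`, every `Q t` with `0 < t` owns `pa (Q t)`, and `pa (Q t)` is a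
neighbour of its parent, an earlier vertex of the list. -/
structure AltTree (m : ℕ) (N : ℕ → Set ℕ) (own Q pa par : ℕ → ℕ) (tl r : ℕ) : Prop where
  pos : 0 < tl
  root : Q 0 = r
  root_mem : 1 ≤ r ∧ r ≤ m
  root_free : ¬ Owned own r
  owns : ∀ t < tl, 0 < t → own (pa (Q t)) = Q t ∧ Q t ≠ 0
  parent : ∀ t < tl, 0 < t → ∃ t' < t, Q t' = par (pa (Q t)) ∧ pa (Q t) ∈ N (Q t')
  inj : ∀ t < tl, ∀ t' < tl, Q t = Q t' → t = t'

variable {m : ℕ} {N : ℕ → Set ℕ} {own Q pa par vis st E : ℕ → ℕ} {tl r hd p z : ℕ}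

/-- The invariant of the search: the cells `a` with `vis a = z` have been visited, the lists of the
left vertices `Q t`, `t < hd`, have been read, and that of `Q hd` up to `p`. -/
structure Search (m : ℕ) (st E own Q pa par vis : ℕ → ℕ) (tl r hd p z : ℕ) : Prop where
  tree : AltTree m (nbr st E) own Q pa par tl r
  hd_le : hd ≤ tl
  vis_le : ∀ a, vis a ≤ z
  vis_own : ∀ a, vis a = z → own a ≠ 0 ∧ ∃ t < tl, Q t = own a
  vis_pa : ∀ t < tl, 0 < t → vis (pa (Q t)) = z
  done : ∀ t < hd, ∀ a ∈ nbr st E (Q t), vis a = z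
  cur : hd < tl → st (Q hd) ≤ p ∧ p ≤ st (Q hd + 1) ∧ ∀ p', st (Q hd) ≤ p' → p' < p → vis (E p') = z

theorem AltTree.mem_Icc (h : AltTree m N own Q pa par tl r) (hM : Matching m N own) {t : ℕ}
    (ht : t < tl) : 1 ≤ Q t ∧ Q t ≤ m := by
  rcases Nat.eq_zero_or_pos t with rfl | h0
  · rw [h.root]; exact h.root_mem
  · obtain ⟨h1, h2⟩ := h.owns t ht h0
    have := (hM.mem (pa (Q t)) (by rwa [h1])).1
    omega

theorem AltTree.le (h : AltTree m N own Q pa par tl r) (hM : Matching m N own) : tl ≤ m := by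
  have := Finset.card_le_card_of_injOn (s := Finset.range tl) (t := Finset.Icc 1 m) Q
    (fun t ht => by have := h.mem_Icc hM (t := t) (by simpa using ht); simpa using this)
    (fun t ht t' ht' => h.inj t (by simpa using ht) t' (by simpa using ht'))
  simpa using this

theorem Search.init (hr : 1 ≤ r ∧ r ≤ m) (hfree : ¬ Owned own r) (hst : st r ≤ st (r + 1))
    (hvis : ∀ a, vis a < z) : Search m st E own (update Q 0 r) pa par vis 1 r 0 (st r) z where
  tree := ⟨by omega, by simp, hr, hfree, by grind, by grind, by grind⟩
  hd_le := by omega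
  vis_le a := (hvis a).le
  vis_own a ha := absurd ha (hvis a).ne
  vis_pa := by grind
  done := by grind
  cur := by grind

theorem Search.pass (h : Search m st E own Q pa par vis tl r hd p z) (hp : p < st (Q hd + 1))
    (hv : vis (E p) = z) : Search m st E own Q pa par vis tl r hd (p + 1) z :=
  { h with cur := by have := h.cur; grind }

theorem Search.next (h : Search m st E own Q pa par vis tl r hd p z) (hlt : hd < tl)
    (hp : st (Q hd + 1) ≤ p) (hst : ∀ b ∈ Finset.Icc 1 m, st b ≤ st (b + 1))
    (hM : Matching m (nbr st E) own) :
    Search m st E own Q pa par vis tl r (hd + 1) (st (Q (hd + 1))) z :=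
  { h with
    hd_le := hlt
    done := by
      intro t ht a ha
      by_cases htt : t = hd
      · subst htt
        obtain ⟨p', hp', rfl⟩ := ha
        exact (h.cur hlt).2.2 p' hp'.1 (hp'.2.trans_le hp)
      · exact h.done t (by omega) a ha
    cur := by
      intro hlt'
      refine ⟨le_rfl, hst _ ?_, by omega⟩
      simpa using h.tree.mem_Icc hM hlt' }

theorem Search.push (h : Search m st E own Q pa par vis tl r hd p z) (hlt : hd < tl)
    (hM : Matching m (nbr st E) own)
    (hp : p < st (Q hd + 1)) (hv : vis (E p) ≠ z) (ho : own (E p) ≠ 0) :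
    Search m st E own (update Q tl (own (E p))) (update pa (own (E p)) (E p))
      (update par (E p) (Q hd)) (update vis (E p) z) (tl + 1) r hd (p + 1) z := by
  have hnew : ∀ t < tl, Q t ≠ own (E p) := by
    intro t ht he
    rcases Nat.eq_zero_or_pos t with rfl | h0
    · exact h.tree.root_free ⟨E p, by rw [← he, h.tree.root]⟩
    · have := (h.tree.owns t ht h0).1
      rw [he] at this
      have h2 := h.vis_pa t ht h0
      rw [he, ← hM.inj (E p) (pa (own (E p))) ho this.symm] at h2
      exact hv h2
  have hpa : ∀ t < tl, 0 < t → pa (Q t) ≠ E p := fun t ht h0 he => hv (he ▸ h.vis_pa t ht h0)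
  have hmem := mem_nbr (E := E) (h.cur hlt).1 hp
  obtain ⟨⟨t1, t2, t3, t4, t5, t6, t7⟩, h1, h2, h3, h4, h5, h6⟩ := h
  refine ⟨⟨by omega, ?_, t3, t4, ?_, ?_, ?_⟩, by omega, ?_, ?_, ?_, ?_, ?_⟩
  · rw [update_of_ne (by omega)]; exact t2
  · intro t ht h0
    by_cases htt : t = tl
    · subst htt; simp [ho]
    · rw [update_of_ne htt, update_of_ne (hnew t (by omega))]
      exact t5 t (by omega) h0
  · intro t ht h0
    by_cases htt : t = tl
    · subst htt
      refine ⟨hd, hlt, ?_, ?_⟩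
      · rw [update_of_ne (by omega)]; simp
      · rw [update_of_ne (by omega)]; simpa using hmem
    · obtain ⟨t', ht', e1, e2⟩ := t6 t (by omega) h0
      refine ⟨t', ht', ?_⟩
      rw [update_of_ne htt, update_of_ne (hnew t (by omega)), update_of_ne (by omega),
        update_of_ne (hpa t (by omega) h0)]
      exact ⟨e1, e2⟩
  · grind [update_apply]
  · grind [update_apply]
  · intro a ha
    by_cases haa : a = E p
    · subst haa; exact ⟨ho, tl, by omega, update_self ..⟩
    · rw [update_of_ne haa] at ha
      obtain ⟨h0, t, ht, he⟩ := h3 a ha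
      exact ⟨h0, t, by omega, by rwa [update_of_ne (by omega)]⟩
  · intro t ht h0
    by_cases htt : t = tl
    · subst htt; simp
    · rw [update_of_ne htt, update_of_ne (hnew t (by omega)),
        update_of_ne (hpa t (by omega) h0)]
      exact h4 t (by omega) h0
  · intro t ht a ha
    rw [update_of_ne (by omega)] at ha
    have := h5 t ht a ha
    grind [update_apply]
  · intro _
    rw [update_of_ne (by omega)]
    grind [update_apply]

/-- A search that ends without reaching a free right vertex exhibits a violation of Hall's
condition: the neighbours of the vertices in the tree are owned by those other than the root. -/
theorem Search.not_hasMatching (h : Search m st E own Q pa par vis tl r tl p z)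
    (hM : Matching m (nbr st E) own) : ¬ HasMatching m (nbr st E) := by
  classical
  rintro ⟨g, hg, hgi⟩
  set S := (Finset.range tl).image Q
  have hS : ∀ b ∈ S, b ∈ Finset.Icc 1 m ∧ vis (g b) = z := by
    intro b hb
    obtain ⟨t, ht, rfl⟩ := Finset.mem_image.1 hb
    have hb := h.tree.mem_Icc hM (Finset.mem_range.1 ht)
    exact ⟨Finset.mem_Icc.2 hb, h.done t (Finset.mem_range.1 ht) _ (hg _ (Finset.mem_Icc.2 hb))⟩
  have hr : r ∈ S := Finset.mem_image.2 ⟨0, Finset.mem_range.2 h.tree.pos, h.tree.root⟩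
  have hmaps : ∀ b ∈ S, own (g b) ∈ S.erase r := by
    intro b hb
    obtain ⟨-, t, ht, he⟩ := h.vis_own _ (hS b hb).2
    refine Finset.mem_erase.2 ⟨fun he => h.tree.root_free ⟨_, he⟩, ?_⟩
    exact Finset.mem_image.2 ⟨t, Finset.mem_range.2 ht, he⟩
  have hcard := Finset.card_le_card_of_injOn (s := S) (t := S.erase r) (fun b => own (g b)) hmaps
    (fun b hb b' hb' he => hgi (hS b hb).1 (hS b' hb').1
      (hM.inj _ _ (h.vis_own _ (hS b hb).2).1 he))
  rw [Finset.card_erase_of_mem hr] at hcard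
  have := Finset.card_pos.2 ⟨r, hr⟩
  omega

/-! ### Augmenting along a path -/

theorem AltTree.update_par (h : AltTree m N own Q pa par tl r) {a b : ℕ} (ha : own a = 0) :
    AltTree m N own Q pa (update par a b) tl r :=
  { h with
    parent := by
      intro t ht h0
      have h1 := h.owns t ht h0
      have h2 := h.parent t ht h0
      rwa [update_of_ne (by rintro rfl; omega)] }

/-- The invariant of the augmentation: `own` arises from the matching `own₀` by changes along the
alternating path below `Q t`, and `a` is to be given to `Q t` next. Apart from the old owner of `a`,
the matched vertices are the same as for `own₀`, and the path above `Q t` is unchanged. -/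
structure Flip (m : ℕ) (N : ℕ → Set ℕ) (own₀ own Q pa : ℕ → ℕ) (a t : ℕ) : Prop where
  matching : Matching m N (update own a 0)
  owned : ∀ b, b ≠ 0 → (Owned (update own a 0) b ↔ Owned own₀ b)
  mem : a ∈ N (Q t)
  path : ∀ t' ≤ t, 0 < t' → update own a 0 (pa (Q t')) = Q t'

variable {own₀ : ℕ → ℕ} {a t : ℕ}

theorem Flip.init (h : AltTree m N own Q pa par tl r) (hM : Matching m N own) (ht : t < tl)
    (ha : own a = 0) (hmem : a ∈ N (Q t)) : Flip m N own own Q pa a t := by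
  have hu : update own a 0 = own := by rw [← ha, update_eq_self]
  exact ⟨by rwa [hu], by simp [hu], hmem, fun t' ht' h0 => by
    rw [hu]; exact (h.owns t' (by omega) h0).1⟩

/-- Give `a` to `Q t`, and continue with the vertex that `Q t` had before and its parent. -/
theorem Flip.step (h : AltTree m N own₀ Q pa par tl r) (ht : t < tl) (hM : Matching m N own₀)
    (hF : Flip m N own₀ own Q pa a t) (h0 : Q t ≠ r) :
    ∃ t' < t, Q t' = par (pa (Q t)) ∧
      Flip m N own₀ (update own a (Q t)) Q pa (pa (Q t)) t' := by
  have ht0 : 0 < t := Nat.pos_of_ne_zero (by rintro rfl; exact h0 h.root)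
  obtain ⟨t', ht', e1, e2⟩ := h.parent t ht ht0
  have hb := h.mem_Icc hM ht
  have hpath := hF.path t le_rfl ht0
  have hne : pa (Q t) ≠ a := by
    intro he; rw [he, update_self] at hpath; omega
  have huu : update (update own a (Q t)) (pa (Q t)) 0
      = update (update (update own a 0) (pa (Q t)) 0) a (Q t) := by
    rw [update_comm hne]; simp
  refine ⟨t', ht', e1, ?_, ?_, e2, ?_⟩
  · rw [huu]
    refine (hF.matching.update (by omega) (by simp) (by simp)).update hb.2 (fun _ => hF.mem) ?_
    intro _ a' ha'
    by_contra hna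
    by_cases haa : a' = pa (Q t)
    · subst haa; rw [update_self] at ha'; omega
    · rw [update_of_ne haa] at ha'
      exact haa (hF.matching.inj _ _ (by rw [ha']; omega) (ha'.trans hpath.symm))
  · intro b hb0
    rw [← hF.owned b hb0, huu]
    constructor
    · rintro ⟨a', ha'⟩
      by_cases h1 : a' = a
      · subst h1; rw [update_self] at ha'; exact ⟨_, ha' ▸ hpath⟩
      · rw [update_of_ne h1] at ha'
        by_cases h2 : a' = pa (Q t)
        · subst h2; rw [update_self] at ha'; omega
        · rw [update_of_ne h2] at ha'; exact ⟨a', ha'⟩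
    · rintro ⟨a', ha'⟩
      by_cases h1 : b = Q t
      · exact ⟨a, by rw [update_self, h1]⟩
      · refine ⟨a', ?_⟩
        rw [update_of_ne, update_of_ne]
        · exact ha'
        · rintro rfl; exact h1 (ha'.symm.trans hpath)
        · rintro rfl; rw [update_self] at ha'; omega
  · intro t'' ht'' h0''
    have h1 := hF.path t'' (by omega) h0''
    have hQ : Q t'' ≠ Q t := fun he => by have := h.inj t'' (by omega) t ht he; omega
    have hb'' := h.mem_Icc hM (t := t'') (by omega)
    rw [huu, update_of_ne, update_of_ne]
    · exact h1
    · intro he; rw [he, hpath] at h1; exact hQ h1.symm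
    · intro he; rw [he, update_self] at h1; omega

theorem Flip.matching_update (hF : Flip m N own₀ own Q pa a t) (hr : Q t ≤ m)
    (hfree : ¬ Owned own₀ (Q t)) : Matching m N (update own a (Q t)) := by
  have := hF.matching.update hr (fun _ => hF.mem) fun h0 a' ha' =>
    (hfree ((hF.owned _ h0).1 ⟨a', ha'⟩)).elim
  simpa using this

theorem Flip.owned_update (hF : Flip m N own₀ own Q pa a t) {b : ℕ} (hb : b ≠ 0) :
    Owned (update own a (Q t)) b ↔ b = Q t ∨ Owned own₀ b := by
  rw [← hF.owned b hb]
  constructor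
  · rintro ⟨a', ha'⟩
    by_cases h1 : a' = a
    · subst h1; rw [update_self] at ha'; exact .inl ha'.symm
    · rw [update_of_ne h1] at ha'; exact .inr ⟨a', by rwa [update_of_ne h1]⟩
  · rintro (rfl | ⟨a', ha'⟩)
    · exact ⟨a, update_self ..⟩
    · have h1 : a' ≠ a := by rintro rfl; rw [update_self] at ha'; omega
      rw [update_of_ne h1] at ha'
      exact ⟨a', by rwa [update_of_ne h1]⟩

/-- The invariant of the repair phase: the unmatched vertices are `U h, …, U (u - 1)`. -/
structure Repair (m : ℕ) (N : ℕ → Set ℕ) (own U : ℕ → ℕ) (u h : ℕ) : Prop where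
  matching : Matching m N own
  mem : ∀ t < u, 1 ≤ U t ∧ U t ≤ m
  inj : ∀ t < u, ∀ t' < u, U t = U t' → t = t'
  owned : ∀ b ∈ Finset.Icc 1 m, (¬ Owned own b ↔ ∃ t, h ≤ t ∧ t < u ∧ U t = b)

variable {U lev ptr : ℕ → ℕ} {u h L i b : ℕ}

theorem Auction.repair (hA : Auction m L st E lev ptr own U u i b) (hi : m < i) :
    Repair m (nbr st E) own U u 0 where
  matching := hA.matching
  mem t ht := ⟨(hA.quit t ht).1, (hA.quit t ht).2.1⟩
  inj := hA.quit_inj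
  owned b' hb' := by
    have h1 := hA.cover b' hb' (by simp at hb'; omega)
    have h2 := hA.quit
    constructor
    · intro hn
      rcases h1 with h1 | h1 | ⟨t, ht, h1⟩
      · omega
      · exact (hn h1).elim
      · exact ⟨t, by omega, ht, h1⟩
    · rintro ⟨t, -, ht, rfl⟩
      exact (h2 t ht).2.2.2.2

theorem Repair.augment (hR : Repair m N own U u h) (hh : h < u)
    (hF : Flip m N own own₀ Q pa a t) (ht : Q t = U h) :
    Repair m N (update own₀ a (U h)) U u (h + 1) where
  matching := by
    have hm := hR.mem h hh
    rw [← ht] at hm ⊢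
    exact hF.matching_update hm.2 ((hR.owned _ (by simpa using hm)).2 ⟨h, le_rfl, hh, ht.symm⟩)
  mem := hR.mem
  inj := hR.inj
  owned b' hb' := by
    have h1 := hR.owned b' hb'
    have h2 := hF.owned_update (b := b') (by simp at hb'; omega)
    rw [ht] at h2
    rw [h2, not_or, h1]
    constructor
    · rintro ⟨hne, t, h3, h4, rfl⟩
      exact ⟨t, by grind, h4, rfl⟩
    · rintro ⟨t, h3, h4, rfl⟩
      refine ⟨fun he => ?_, t, by omega, h4, rfl⟩
      have := hR.inj t h4 h hh he
      omega

theorem Repair.hasMatching (hR : Repair m N own U u h) (hh : u ≤ h) : HasMatching m N := by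
  refine hR.matching.hasMatching fun b hb => ?_
  by_contra hn
  obtain ⟨t, h1, h2, -⟩ := (hR.owned b hb).1 hn
  omega

end

section

/-! ### Monomials and matchings -/

/-- The right vertices that stand for the variable `x`, one for each of its `k` permitted
occurrences. -/
def copies (n k x : ℕ) : Set ℕ := {a | ∃ j < k, a = x + n * j}

variable {m s n : ℕ}

theorem PiSigma.chosenMonomial_apply (f : PiSigma m s n) (φ : f.Choice) (x : Fin n) :
    f.chosenMonomial φ x
      = (Finset.univ.filter fun i => (f.clause i).get (φ i) = x).card := by
  classical
  simp [chosenMonomial, Finsupp.finsetSum_apply, Finsupp.single_apply]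

theorem copies_decode {n x y j j' : ℕ} (hx : x < n) (hy : y < n) (h : x + n * j = y + n * j') :
    x = y ∧ j = j' := by
  have h1 := congrArg (· % n) h
  simp only [Nat.add_mul_mod_self_left, Nat.mod_eq_of_lt hx, Nat.mod_eq_of_lt hy] at h1
  subst h1
  refine ⟨rfl, Nat.eq_of_mul_eq_mul_left (by omega : 0 < n) (by omega)⟩

/-- A selection of terms that uses every variable less than `c` times is a matching of the clauses
into `c - 1` copies of the variables. -/
theorem PiSigma.hasCMonomial_iff (f : PiSigma m s n) {c : ℕ} (hc : 0 < c) {N : ℕ → Set ℕ}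
    (hN : ∀ i : Fin m, N (i + 1) = ⋃ x ∈ f.clause i, copies n (c - 1) x) :
    f.HasCMonomial c ↔ HasMatching m N := by
  classical
  have hN' : ∀ (i : Fin m) a, a ∈ N (i + 1) ↔ ∃ x ∈ f.clause i, ∃ j < c - 1, a = x + n * j := by
    intro i a; simp [hN, copies]
  constructor
  · rintro ⟨φ, hφ⟩
    let v : Fin m → Fin n := fun i => (f.clause i).get (φ i)
    -- Number the clauses in which the same variable has been selected.
    let rk : Fin m → ℕ := fun i => (Finset.univ.filter fun i' => i' < i ∧ v i' = v i).card
    have hrk : ∀ i, rk i < c - 1 := by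
      intro i
      have h1 : rk i < (Finset.univ.filter fun i' => v i' = v i).card := by
        refine Finset.card_lt_card (Finset.ssubset_iff_of_subset ?_ |>.2 ⟨i, by simp, by simp⟩)
        intro i'; simp
      rw [← f.chosenMonomial_apply φ (v i)] at h1
      have := hφ (v i) (by rw [Finsupp.mem_support_iff]; omega)
      omega
    have hlt : ∀ i i', i < i' → v i = v i' → rk i < rk i' := by
      intro i i' hi hv
      refine Finset.card_lt_card (Finset.ssubset_iff_of_subset ?_ |>.2
        ⟨i, by simp [hi, hv], by simp⟩)
      intro i''; simp only [Finset.mem_filter, Finset.mem_univ, true_and]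
      rintro ⟨h1, h2⟩
      exact ⟨h1.trans hi, h2.trans hv⟩
    let g : ℕ → ℕ := fun b => if h : b - 1 < m then v ⟨b - 1, h⟩ + n * rk ⟨b - 1, h⟩ else 0
    have hg : ∀ i : Fin m, g (i + 1) = v i + n * rk i := by
      intro i; simp [g]
    have hb : ∀ b ∈ Finset.Icc 1 m, ∃ i : Fin m, b = i + 1 := by
      intro b hb
      rw [Finset.mem_Icc] at hb
      exact ⟨⟨b - 1, by omega⟩, by simp; omega⟩
    refine ⟨g, fun b h => ?_, fun b h b' h' he => ?_⟩
    · obtain ⟨i, rfl⟩ := hb b h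
      rw [hN', hg]
      exact ⟨v i, List.get_mem _ _, rk i, hrk i, rfl⟩
    · obtain ⟨i, rfl⟩ := hb b h
      obtain ⟨i', rfl⟩ := hb b' h'
      rw [hg, hg] at he
      obtain ⟨h1, h2⟩ := copies_decode (v i).2 (v i').2 he
      have h1 := Fin.ext h1
      rcases lt_trichotomy i i' with h | h | h
      · have := hlt i i' h h1; omega
      · rw [h]
      · have := hlt i' i h h1.symm; omega
  · rintro ⟨g, hg, hgi⟩
    have hmem : ∀ i : Fin m, (i : ℕ) + 1 ∈ Finset.Icc 1 m := fun i => by simp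
    have hx : ∀ i : Fin m, ∃ t : Fin (f.clause i).length, ∃ j < c - 1,
        g (i + 1) = (f.clause i).get t + n * j := by
      intro i
      obtain ⟨x, hx, j, hj, h⟩ := (hN' i _).1 (hg _ (hmem i))
      obtain ⟨t, rfl⟩ := List.get_of_mem hx
      exact ⟨t, j, hj, h⟩
    choose φ j hj he using hx
    refine ⟨φ, fun x _ => ?_⟩
    rw [f.chosenMonomial_apply]
    have := Finset.card_le_card_of_injOn (s := Finset.univ.filter fun i =>
      (f.clause i).get (φ i) = x) (t := Finset.range (c - 1)) j (fun i _ => by simpa using hj i) ?_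
    · rw [Finset.card_range] at this
      omega
    · intro i hi i' hi' hjj
      simp only [Finset.coe_filter, Finset.mem_univ, true_and, Set.mem_ofPred_eq] at hi hi'
      have : g (i + 1) = g (i' + 1) := by rw [he, he, hi, hi', hjj]
      have := hgi (hmem i) (hmem i') this
      exact Fin.ext (by omega)

/-! ### Reading the input -/

theorem getD_of_drop_eq {l t : List ℕ} {q x : ℕ} (h : l.drop q = x :: t) :
    l.getD q 0 = x ∧ l.drop (q + 1) = t := by
  constructor
  · have := congrArg (·.head?) h
    simp only [List.head?_drop, List.head?_cons] at this
    simp [List.getD, this]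
  · rw [← List.drop_drop, h]; rfl

/-- The words that describe the clause `F_{i+1}`; none for `i ≥ m`. -/
def PiSigma.block (f : PiSigma m s n) (i : ℕ) : List ℕ :=
  if h : i < m then
    (f.clause ⟨i, h⟩).length :: (f.clause ⟨i, h⟩).map (fun x : Fin n => (x : ℕ))
  else []

/-- The words that describe the clauses from `F_{i+1}` on. -/
def PiSigma.blocksFrom (f : PiSigma m s n) (i : ℕ) : List ℕ :=
  ((List.range' i (m - i)).map f.block).flatten

theorem PiSigma.encode_eq (f : PiSigma m s n) (c : ℕ) :
    f.encode c = c :: n :: m :: f.blocksFrom 0 := by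
  have : (List.ofFn fun i : Fin m => (f.clause i).length ::
      (f.clause i).map (fun x : Fin n => (x : ℕ))) = (List.range' 0 (m - 0)).map f.block := by
    refine List.ext_getElem (by simp) fun i h1 h2 => ?_
    have : i < m := by simpa using h1
    simp [block, this]
  rw [encode, this, blocksFrom]

theorem PiSigma.blocksFrom_eq (f : PiSigma m s n) (i : Fin m) :
    f.blocksFrom i = (f.clause i).length :: ((f.clause i).map (fun x : Fin n => (x : ℕ))
      ++ f.blocksFrom (i + 1)) := by
  have h : m - i = (m - (i + 1)) + 1 := by omega
  rw [blocksFrom, h, List.range'_succ, List.map_cons, List.flatten_cons]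
  simp [block, blocksFrom]

end

open Prog Test

section

/-! ### The program -/

namespace Reg

-- The register `ans` holds the answer, and `n`, `m`, `k = c - 1`, `kn = k * n`, `L` hold parameters.
-- Vertices are held in `b`, `o`, `r` (clauses, numbered from `1`, so that `0` can stand for none)
-- and `a` (copies). The register `p` points into the lists of the graph, and `q` into the input.
@[simp] abbrev ans : ℕ := 0
@[simp] abbrev n : ℕ := 1
@[simp] abbrev m : ℕ := 2
@[simp] abbrev k : ℕ := 3
@[simp] abbrev kn : ℕ := 4
@[simp] abbrev L : ℕ := 5
@[simp] abbrev tmp : ℕ := 6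
@[simp] abbrev i : ℕ := 7
@[simp] abbrev b : ℕ := 8
@[simp] abbrev p : ℕ := 9
@[simp] abbrev e : ℕ := 10
@[simp] abbrev a : ℕ := 11
@[simp] abbrev o : ℕ := 12
@[simp] abbrev lo : ℕ := 13
@[simp] abbrev lb : ℕ := 14
@[simp] abbrev u : ℕ := 15
@[simp] abbrev h : ℕ := 16
@[simp] abbrev r : ℕ := 17
@[simp] abbrev hd : ℕ := 18
@[simp] abbrev tl : ℕ := 19
@[simp] abbrev found : ℕ := 20
@[simp] abbrev v : ℕ := 21
@[simp] abbrev q : ℕ := 22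
@[simp] abbrev pos : ℕ := 23
@[simp] abbrev sq : ℕ := 24
@[simp] abbrev j : ℕ := 25

end Reg

namespace Arr

-- The array `inp` is the input; `E` contains the adjacency lists, that of `b` in the cells from
-- `st b` to `st (b + 1) - 1`; `ptr` and `lev` are as in `Prices`, and `par`, `pa` and `vis` as in `Search`;
-- `own` is the matching, `quit` the list of the clauses that gave up, `queue` that of the search.
@[simp] abbrev inp : ℕ := 0
@[simp] abbrev st : ℕ := 1
@[simp] abbrev E : ℕ := 2
@[simp] abbrev ptr : ℕ := 3
@[simp] abbrev lev : ℕ := 4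
@[simp] abbrev own : ℕ := 5
@[simp] abbrev quit : ℕ := 6
@[simp] abbrev queue : ℕ := 7
@[simp] abbrev vis : ℕ := 8
@[simp] abbrev par : ℕ := 9
@[simp] abbrev pa : ℕ := 10

end Arr

/-- `r := r + 1` -/
@[simp] def inc (r : ℕ) : Prog := const Reg.tmp 1 ;; add r r Reg.tmp

/-- `e := st (b + 1)`, the end of the list of `b`. -/
@[simp] def loadEnd : Prog :=
  const Reg.tmp 1 ;; add Reg.tmp Reg.b Reg.tmp ;; load Reg.e Arr.st Reg.tmp

/-- The next left vertex enters the auction. -/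
@[simp] def enter : Prog := inc Reg.i ;; move Reg.b Reg.i

/-- One move of the bidder `b`: it looks at the next right vertex of its list, or, at the end of the
list, rises to the next level and possibly gives up. -/
def auctionBody : Prog :=
  load Reg.p Arr.ptr Reg.b ;; loadEnd ;;
  cond (lt Reg.p Reg.e)
    (load Reg.a Arr.E Reg.p ;; inc Reg.p ;; store Arr.ptr Reg.b Reg.p ;;
      load Reg.o Arr.own Reg.a ;; const Reg.tmp 0 ;;
      cond (eq Reg.o Reg.tmp)
        (store Arr.own Reg.a Reg.b ;; enter)
        (load Reg.lo Arr.lev Reg.o ;; load Reg.lb Arr.lev Reg.b ;;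
          cond (lt Reg.lo Reg.lb)
            (store Arr.own Reg.a Reg.b ;; move Reg.b Reg.o)
            skip))
    (load Reg.lb Arr.lev Reg.b ;; inc Reg.lb ;; store Arr.lev Reg.b Reg.lb ;;
      load Reg.p Arr.st Reg.b ;; store Arr.ptr Reg.b Reg.p ;;
      cond (le Reg.L Reg.lb)
        (store Arr.quit Reg.u Reg.b ;; inc Reg.u ;; enter)
        skip)

/-- The auction. -/
def auction : Prog :=
  (const Reg.i 1 ;; const Reg.b 1 ;; const Reg.u 0) ;; loop (le Reg.i Reg.m) auctionBody

/-- One step of the search: look at the next right vertex in the list of the head of the queue. When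
a free vertex is found, emptying the queue ends the loop, and `a` and `b` keep the edge that leads to
it. The marks in `vis` are the number `h` of the search, so that they need not be erased. -/
def searchBody : Prog :=
  load Reg.b Arr.queue Reg.hd ;; loadEnd ;;
  cond (lt Reg.p Reg.e)
    (load Reg.a Arr.E Reg.p ;; inc Reg.p ;; load Reg.v Arr.vis Reg.a ;;
      cond (ne Reg.v Reg.h)
        (store Arr.vis Reg.a Reg.h ;; store Arr.par Reg.a Reg.b ;; load Reg.o Arr.own Reg.a ;;
          const Reg.tmp 0 ;;
          cond (ne Reg.o Reg.tmp)
            (store Arr.queue Reg.tl Reg.o ;; inc Reg.tl ;; store Arr.pa Reg.o Reg.a)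
            (const Reg.found 1 ;; move Reg.hd Reg.tl))
        skip)
    (inc Reg.hd ;; load Reg.b Arr.queue Reg.hd ;; load Reg.p Arr.st Reg.b)

/-- The search for a free right vertex from the unmatched left vertex `r`. -/
def search : Prog :=
  (const Reg.hd 0 ;; const Reg.tl 1 ;; store Arr.queue Reg.hd Reg.r ;; load Reg.p Arr.st Reg.r ;;
    const Reg.found 0) ;;
  loop (lt Reg.hd Reg.tl) searchBody

/-- One step of the augmentation. -/
def flipBody : Prog :=
  load Reg.o Arr.pa Reg.b ;; store Arr.own Reg.a Reg.b ;; move Reg.a Reg.o ;;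
  load Reg.b Arr.par Reg.a

/-- The augmentation along the path from the right vertex `a` back to `r`. -/
def flip : Prog := loop (ne Reg.b Reg.r) flipBody ;; store Arr.own Reg.a Reg.b

/-- Match one more vertex, or stop with the answer `0`; putting `h := u` ends the loop. -/
def repairBody : Prog :=
  (load Reg.r Arr.quit Reg.h ;; inc Reg.h) ;; search ;; const Reg.tmp 1 ;;
  cond (eq Reg.found Reg.tmp) flip (const Reg.ans 0 ;; move Reg.h Reg.u)

/-- Match the vertices that gave up in the auction, if these are few. -/
def repair : Prog :=
  cond (le Reg.u Reg.L)
    ((const Reg.ans 1 ;; const Reg.h 0) ;; loop (lt Reg.h Reg.u) repairBody)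
    skip

/-- Read `c`, `n` and `m`, and put `k = c - 1`. -/
def readParams : Prog :=
  const Reg.j 0 ;; load Reg.k Arr.inp Reg.j ;; const Reg.j 1 ;; sub Reg.k Reg.k Reg.j ;;
  load Reg.n Arr.inp Reg.j ;; const Reg.j 2 ;; load Reg.m Arr.inp Reg.j

/-- `kn := k * n` -/
def mulParams : Prog :=
  (const Reg.kn 0 ;; const Reg.j 0) ;;
  loop (lt Reg.j Reg.k) (add Reg.kn Reg.kn Reg.n ;; inc Reg.j)

/-- Compute the least `L` with `m ≤ L ^ 2`; the register `sq` holds `L ^ 2`. -/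
def sqrtParam : Prog :=
  (const Reg.L 0 ;; const Reg.sq 0) ;;
  loop (lt Reg.sq Reg.m)
    (add Reg.sq Reg.sq Reg.L ;; add Reg.sq Reg.sq Reg.L ;; inc Reg.sq ;; inc Reg.L)

/-- Write the next copy of the current variable. -/
def copyBody : Prog :=
  store Arr.E Reg.pos Reg.a ;; inc Reg.pos ;; add Reg.a Reg.a Reg.n

/-- Write all copies of the next variable of the clause. -/
def varBody : Prog :=
  (load Reg.a Arr.inp Reg.q ;; inc Reg.q) ;; loop (lt Reg.a Reg.kn) copyBody

/-- Write the adjacency list of the clause `b`. -/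
def clauseBody : Prog :=
  (store Arr.st Reg.b Reg.pos ;; store Arr.ptr Reg.b Reg.pos ;; load Reg.e Arr.inp Reg.q ;;
    inc Reg.q ;; add Reg.e Reg.e Reg.q) ;;
  loop (lt Reg.q Reg.e) varBody ;; inc Reg.b

/-- Write all adjacency lists. -/
def build : Prog :=
  (const Reg.q 3 ;; const Reg.pos 0 ;; const Reg.b 1) ;;
  loop (le Reg.b Reg.m) clauseBody ;; store Arr.st Reg.b Reg.pos

/-- The test for a `c`-monomial. -/
def cMonomialTest : Prog :=
  readParams ;; mulParams ;; sqrtParam ;; build ;; auction ;; repair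

/-! ### Verification of the auction -/

/-- Bounds for the graph: `m` left vertices, lists of length at most `d`, and everything that is
counted fits into a word. -/
structure Bounds (W m L d : ℕ) (st : ℕ → ℕ) : Prop where
  one_le_m : 1 ≤ m
  one_le_L : 1 ≤ L
  st_le : ∀ b ∈ Finset.Icc 1 m, st b ≤ st (b + 1)
  st_add : ∀ b ∈ Finset.Icc 1 m, st (b + 1) ≤ st b + d
  st_word : ∀ b ∈ Finset.Icc 1 m, st (b + 1) ≤ W
  m_word : m + 2 ≤ W
  L_word : L + 1 ≤ W

variable {W m L d : ℕ} {st E : ℕ → ℕ}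

/-- The data that no phase after the construction of the graph changes. -/
def Frame (m L : ℕ) (st E : ℕ → ℕ) (σ : State) : Prop :=
  σ.reg Reg.m = m ∧ σ.reg Reg.L = L ∧ σ.arr Arr.st = st ∧ σ.arr Arr.E = E

/-- The progress that the bidders have made. It increases with every step of the auction: a step moves
one pointer, or raises one level and resets a pointer that had moved by at most `d`. -/
def progress (m d : ℕ) (st lev ptr : ℕ → ℕ) : ℕ :=
  ∑ b ∈ Finset.Icc 1 m, (lev b * (d + 1) + (ptr b - st b))

theorem progress_advance {lev ptr : ℕ → ℕ} {b : ℕ} (hb : b ∈ Finset.Icc 1 m) (hp : st b ≤ ptr b) :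
    progress m d st lev ptr < progress m d st lev (update ptr b (ptr b + 1)) := by
  refine Finset.sum_lt_sum (fun b' _ => ?_) ⟨b, hb, ?_⟩
  · by_cases h : b' = b
    · subst h; simp; omega
    · simp [h]
  · simp; omega

theorem progress_relabel {lev ptr : ℕ → ℕ} {b : ℕ} (hb : b ∈ Finset.Icc 1 m)
    (hp : ptr b ≤ st b + d) : progress m d st lev ptr
      < progress m d st (update lev b (lev b + 1)) (update ptr b (st b)) := by
  refine Finset.sum_lt_sum (fun b' _ => ?_) ⟨b, hb, ?_⟩
  · by_cases h : b' = b
    · subst h; simp [Nat.add_mul]; omega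
    · simp [h]
  · simp [Nat.add_mul]; omega

theorem progress_lt {lev ptr own U : ℕ → ℕ} {u i b : ℕ} (hB : Bounds W m L d st)
    (hA : Auction m L st E lev ptr own U u i b) :
    progress m d st lev ptr < m * ((L + 1) * (d + 1)) := by
  have : m * ((L + 1) * (d + 1)) = ∑ b ∈ Finset.Icc 1 m, (L + 1) * (d + 1) := by simp
  rw [this]
  refine Finset.sum_lt_sum_of_nonempty (by simpa using hB.one_le_m) fun b hb => ?_
  have h1 := Nat.mul_le_mul_right (d + 1) (hA.lev_le b hb)
  have h2 := hA.prices.ptr_mem b hb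
  have h3 := hB.st_add b hb
  rw [Nat.add_mul]
  omega

/-- The invariant of the auction, read off from the memory; `μ` bounds the number of steps that are
left. -/
def AuctionState (m L d : ℕ) (st E : ℕ → ℕ) (μ : ℕ) (σ : State) : Prop :=
  Frame m L st E σ ∧ σ.reg Reg.ans = 0 ∧ σ.arr Arr.vis = (fun _ => 0) ∧
  Auction m L st E (σ.arr Arr.lev) (σ.arr Arr.ptr) (σ.arr Arr.own) (σ.arr Arr.quit)
    (σ.reg Reg.u) (σ.reg Reg.i) (σ.reg Reg.b) ∧
  m * ((L + 1) * (d + 1)) ≤ progress m d st (σ.arr Arr.lev) (σ.arr Arr.ptr) + μ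

theorem auctionBody_reach (hB : Bounds W m L d st) {μ : ℕ} {σ : State}
    (hσ : AuctionState m L d st E μ σ) (hi : σ.reg Reg.i ≤ σ.reg Reg.m) :
    Reach W auctionBody σ 30 fun σ' => ∃ μ' < μ, AuctionState m L d st E μ' σ' := by
  refine Reach.mono (T := cost auctionBody) (Reach.of_wp ?_) (by decide) fun _ => id
  obtain ⟨⟨rm, rL, ast, aE⟩, rans, avis, hA, hμ⟩ := hσ
  simp only [Reg.m, Reg.L, Arr.st, Arr.E, Arr.vis, Arr.lev, Arr.ptr, Arr.own, Arr.quit, Reg.ans,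
    Reg.u, Reg.i, Reg.b] at rm rL ast aE rans avis hA hμ hi
  rw [rm] at hi
  have hb := hA.active hi
  have hbm : σ.reg 8 ∈ Finset.Icc 1 m := by simp; omega
  have hlt := progress_lt hB hA
  have hptr := hA.prices.ptr_mem _ hbm
  have h1 := hB.st_add _ hbm
  have h2 := hB.st_word _ hbm
  have h3 := hB.m_word
  have h4 := hB.L_word
  have hu := hA.quit_le
  have hadv := progress_advance (d := d) (lev := σ.arr 4) hbm hptr.1
  have hrel := progress_relabel (lev := σ.arr 4) hbm (hptr.2.trans h1)
  simp [auctionBody, AuctionState, Frame, rm, rL, ast, aE, rans, avis]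
  refine ⟨by omega, by omega, fun hp => ⟨by omega, by omega, fun ho => ⟨by omega, by omega, μ - 1,
    by omega, hA.take hi hp ho, by omega⟩, fun ho => ⟨fun hl => ⟨μ - 1, by omega,
      hA.displace hi hp ho hl, by omega⟩,
    fun hl => ⟨μ - 1, by omega, hA.skip hp ho hl, by omega⟩⟩⟩,
    fun hp => ⟨by omega, by omega, fun hl => ⟨by omega, by omega, by omega, by omega,
      μ - 1, by omega, hA.giveUp hi hp hl, by omega⟩,
      fun hl => ⟨μ - 1, by omega, hA.relabel hi hp hl, by omega⟩⟩⟩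

/-- The state in which the graph has been written and everything else is as at the start. -/
def GraphState (m L : ℕ) (st E : ℕ → ℕ) (σ : State) : Prop :=
  Frame m L st E σ ∧ σ.reg Reg.ans = 0 ∧ σ.arr Arr.vis = (fun _ => 0) ∧
  σ.arr Arr.lev = (fun _ => 0) ∧ σ.arr Arr.own = (fun _ => 0) ∧
  ∀ b ∈ Finset.Icc 1 m, σ.arr Arr.ptr b = st b

theorem auction_reach (hB : Bounds W m L d st) {σ : State} (hσ : GraphState m L st E σ) :
    Reach W auction σ (3 + (m * ((L + 1) * (d + 1)) * (30 + 1) + 1)) fun σ' =>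
      ∃ μ, AuctionState m L d st E μ σ' ∧ m < σ'.reg Reg.i := by
  have h3 := hB.m_word
  refine Reach.seq (R := AuctionState m L d st E (m * ((L + 1) * (d + 1)))) ?_ fun σ₁ h₁ =>
    (Reach.loop 30 _ (fun μ σ h hi => by exact auctionBody_reach hB h hi) _ _ h₁).mono le_rfl ?_
  · refine Reach.of_wp ?_
    obtain ⟨⟨rm, rL, ast, aE⟩, rans, avis, alev, aown, aptr⟩ := hσ
    simp only [Reg.m, Reg.L, Arr.st, Arr.E, Arr.vis, Arr.lev, Arr.ptr, Arr.own, Reg.ans]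
      at rm rL ast aE rans avis alev aown aptr
    simp [AuctionState, Frame, rm, rL, ast, aE, rans, avis, alev, aown]
    exact ⟨by omega, Auction.init hB.one_le_L hB.st_le aptr⟩
  · rintro σ' ⟨⟨μ, h⟩, hn⟩
    refine ⟨μ, h, ?_⟩
    have := h.1.1
    simp at hn this ⊢
    omega

end

section

variable {W m L d : ℕ} {st E : ℕ → ℕ}

/-! ### Verification of the search and the augmentation -/

variable {own U : ℕ → ℕ} {u h r : ℕ}

/-- What the search and the augmentation leave unchanged. -/
def RepairFrame (m L : ℕ) (st E U : ℕ → ℕ) (u z r : ℕ) (σ : State) : Prop :=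
  Frame m L st E σ ∧ σ.reg Reg.ans = 1 ∧ σ.arr Arr.quit = U ∧ σ.reg Reg.u = u ∧
  σ.reg Reg.h = z ∧ σ.reg Reg.r = r ∧ ∀ a, σ.arr Arr.vis a ≤ z

/-- A free right vertex, held in a register, has been found next to a vertex of the tree. -/
def Found (m : ℕ) (st E own : ℕ → ℕ) (r : ℕ) (σ : State) : Prop :=
  ∃ tl t, AltTree m (nbr st E) own (σ.arr Arr.queue) (σ.arr Arr.pa) (σ.arr Arr.par) tl r ∧ t < tl ∧
    σ.arr Arr.queue t = σ.reg Reg.b ∧ own (σ.reg Reg.a) = 0 ∧ σ.reg Reg.a ∈ nbr st E (σ.reg Reg.b)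

/-- The invariant of the search, read off from the memory. The number of steps that are left is
bounded by `μ`, since a step moves `p`, or moves `hd` and resets a pointer that had moved by at most
`d`. -/
def SearchState (m L d : ℕ) (st E own U : ℕ → ℕ) (u z r μ : ℕ) (σ : State) : Prop :=
  RepairFrame m L st E U u z r σ ∧ σ.arr Arr.own = own ∧
  ((σ.reg Reg.found = 0 ∧
      Search m st E own (σ.arr Arr.queue) (σ.arr Arr.pa) (σ.arr Arr.par) (σ.arr Arr.vis)
        (σ.reg Reg.tl) r (σ.reg Reg.hd) (σ.reg Reg.p) z ∧
      m * (d + 1) ≤ σ.reg Reg.hd * (d + 1)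
        + (σ.reg Reg.p - st (σ.arr Arr.queue (σ.reg Reg.hd))) + μ) ∨
    (σ.reg Reg.found = 1 ∧ σ.reg Reg.tl ≤ σ.reg Reg.hd ∧ Found m st E own r σ))

theorem searchBody_reach (hB : Bounds W m L d st) (hM : Matching m (nbr st E) own) {z μ : ℕ}
    {σ : State} (hσ : SearchState m L d st E own U u z r μ σ) (ht : σ.reg Reg.hd < σ.reg Reg.tl) :
    Reach W searchBody σ 30 fun σ' => ∃ μ' < μ, SearchState m L d st E own U u z r μ' σ' := by
  refine Reach.mono (T := cost searchBody) (Reach.of_wp ?_) (by decide) fun _ => id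
  obtain ⟨⟨⟨rm, rL, ast, aE⟩, rans, aU, ru, rh, rr, avis⟩, aown, hs⟩ := hσ
  rcases hs with ⟨rf, hS, hμ⟩ | ⟨-, hs, -⟩
  swap
  · omega
  simp only [Reg.m, Reg.L, Arr.st, Arr.E, Arr.vis, Arr.own, Arr.quit, Reg.ans, Reg.u, Reg.h, Reg.r,
    Reg.found, Reg.hd, Reg.tl, Reg.p, Arr.queue, Arr.pa, Arr.par]
    at rm rL ast aE rans avis ht aU ru rh rr aown rf hS hμ
  have hb := hS.tree.mem_Icc hM ht
  have hbm : σ.arr 7 (σ.reg 18) ∈ Finset.Icc 1 m := by simpa using hb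
  have hcur := hS.cur ht
  have hle := hS.tree.le hM
  have h1 := hB.st_add _ hbm
  have h2 := hB.st_word _ hbm
  have h3 := hB.m_word
  have hbd : (σ.reg 18 + 1) * (d + 1) ≤ m * (d + 1) := Nat.mul_le_mul_right _ (by omega)
  rw [Nat.add_mul] at hbd
  simp [searchBody, SearchState, RepairFrame, Frame, rm, rL, ast, aE, rans, aU, ru, rh, rr, aown,
    rf, Found]
  have hvis : ∀ a, update (σ.arr 8) (E (σ.reg 9)) z a ≤ z := by grind [update_apply]
  refine ⟨by omega, by omega, fun hp => ⟨by omega, by omega, fun hv => ⟨fun ho => ⟨by omega, by omega,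
    μ - 1, by omega, hvis, hS.push ht hM hp hv ho, ?_⟩, fun ho => ⟨by omega, ⟨0, by omega⟩, hvis,
      σ.reg 19, hS.tree.update_par ho, σ.reg 18, ht, rfl, ho, mem_nbr hcur.1 hp⟩⟩,
    fun hv => ⟨μ - 1, by omega, avis, hS.pass hp hv, by omega⟩⟩,
    fun hp => ⟨by omega, by omega, μ - 1, by omega, avis, hS.next ht hp hB.st_le hM, ?_⟩⟩
  · rw [update_of_ne (by omega)]
    omega
  · rw [Nat.add_mul]
    omega

/-- The search ends with a free right vertex or with the whole graph that can be reached. -/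
theorem search_reach (hB : Bounds W m L d st) (hM : Matching m (nbr st E) own) {z : ℕ} {σ : State}
    (hσ : RepairFrame m L st E U u z r σ) (hown : σ.arr Arr.own = own) (hr : 1 ≤ r ∧ r ≤ m)
    (hfree : ¬ Owned own r) (hvis : ∀ a, σ.arr Arr.vis a < z) :
    Reach W search σ (5 + (m * (d + 1) * (30 + 1) + 1)) fun σ' =>
      RepairFrame m L st E U u z r σ' ∧ σ'.arr Arr.own = own ∧
      ((σ'.reg Reg.found = 0 ∧ ¬ HasMatching m (nbr st E)) ∨
        (σ'.reg Reg.found = 1 ∧ Found m st E own r σ')) := by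
  have h3 := hB.m_word
  refine Reach.seq (R := SearchState m L d st E own U u z r (m * (d + 1))) ?_ fun σ₁ h₁ =>
    (Reach.loop 30 _ (fun μ σ h ht => by exact searchBody_reach hB hM h ht) _ _ h₁).mono le_rfl ?_
  · refine Reach.of_wp ?_
    obtain ⟨⟨rm, rL, ast, aE⟩, rans, aU, ru, rh, rr, avis⟩ := hσ
    simp only [Reg.m, Reg.L, Arr.st, Arr.E, Arr.vis, Arr.own, Arr.quit, Reg.ans, Reg.u, Reg.h, Reg.r]
      at rm rL ast aE rans avis aU ru rh rr hown hvis
    simp [SearchState, RepairFrame, Frame, rm, rL, ast, aE, rans, aU, ru, rh, rr, hown]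
    exact ⟨by omega, avis, Search.init hr hfree (hB.st_le r (by simpa using hr)) hvis⟩
  · rintro σ' ⟨⟨μ, hF, ho, h | h⟩, hn⟩
    · refine ⟨hF, ho, .inl ⟨h.1, ?_⟩⟩
      have hS := h.2.1
      have : σ'.reg Reg.hd = σ'.reg Reg.tl := by
        have := hS.hd_le
        simp at hn this ⊢
        omega
      rw [this] at hS
      exact hS.not_hasMatching hM
    · exact ⟨hF, ho, .inr ⟨h.1, h.2.2⟩⟩

/-- The invariant of the augmentation, read off from the memory. The position `t` in the queue
decreases, because parents stand in front of their children. -/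
def FlipState (m L : ℕ) (st E own₀ U Q pa par : ℕ → ℕ) (u z r tl t : ℕ) (σ : State) : Prop :=
  RepairFrame m L st E U u z r σ ∧ σ.arr Arr.pa = pa ∧ σ.arr Arr.par = par ∧ t < tl ∧
  Q t = σ.reg Reg.b ∧ Flip m (nbr st E) own₀ (σ.arr Arr.own) Q pa (σ.reg Reg.a) t

theorem flipBody_reach {own₀ Q pa par : ℕ → ℕ} {z tl t : ℕ} (hM : Matching m (nbr st E) own₀)
    (hT : AltTree m (nbr st E) own₀ Q pa par tl r) {σ : State}
    (hσ : FlipState m L st E own₀ U Q pa par u z r tl t σ) (hne : σ.reg Reg.b ≠ σ.reg Reg.r) :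
    Reach W flipBody σ 4 fun σ' =>
      ∃ t' < t, FlipState m L st E own₀ U Q pa par u z r tl t' σ' := by
  refine Reach.of_wp (p := flipBody) ?_
  obtain ⟨⟨⟨rm, rL, ast, aE⟩, rans, aU, ru, rh, rr, avis⟩, apa, apar, ht, hQ, hF⟩ := hσ
  simp only [Reg.m, Reg.L, Arr.st, Arr.E, Arr.vis, Arr.own, Arr.quit, Reg.ans, Reg.u, Reg.h, Reg.r,
    Reg.b, Reg.a, Arr.pa, Arr.par] at rm rL ast aE rans avis aU ru rh rr apa apar hQ hF hne
  obtain ⟨t', ht', hp, hF'⟩ := hF.step hT ht hM (by rw [hQ, ← rr]; exact hne)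
  rw [hQ] at hp hF'
  simp [flipBody, FlipState, RepairFrame, Frame, rm, rL, ast, aE, rans, aU, ru, rh, rr, apa, apar]
  exact ⟨t', ht', avis, by omega, hp, hF'⟩

theorem flip_reach (hR : Repair m (nbr st E) own U u h) (hh : h < u)
    {σ : State} (hσ : RepairFrame m L st E U u (h + 1) (U h) σ) (hown : σ.arr Arr.own = own)
    (hF : Found m st E own (U h) σ) :
    Reach W flip σ (m * (4 + 1) + 1 + 1) fun σ' => RepairFrame m L st E U u (h + 1) (U h) σ' ∧
      Repair m (nbr st E) (σ'.arr Arr.own) U u (h + 1) := by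
  obtain ⟨tl, t, hT, ht, hQ, ha, hmem⟩ := hF
  have hle := hT.le hR.matching
  have h₁ : FlipState m L st E own U (σ.arr Arr.queue) (σ.arr Arr.pa) (σ.arr Arr.par) u (h + 1)
      (U h) tl t σ :=
    ⟨hσ, rfl, rfl, ht, hQ, by
      rw [hown]; exact Flip.init hT hR.matching ht ha (hQ ▸ hmem)⟩
  refine (Reach.seq (Reach.loop 4 _ (fun μ σ h ht => by
    exact flipBody_reach hR.matching hT h ht) _ _ h₁) fun σ₂ h₂ => Reach.of_wp ?_).mono
    (Nat.add_le_add_right (Nat.add_le_add_right (Nat.mul_le_mul_right _ (ht.le.trans hle)) _) _)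
    fun _ => id
  obtain ⟨⟨t₂, hR₂, -, -, ht₂, hQ₂, hF₂⟩, hn⟩ := h₂
  simp at hn
  have hr : σ₂.reg 17 = U h := hR₂.2.2.2.2.2.1
  have hQr : σ.arr Arr.queue t₂ = U h := by rw [hQ₂, ← hr]; exact hn
  have := hR.augment hh hF₂ hQr
  simp [RepairFrame, Frame] at hR₂ this ⊢
  rw [hn, hr]
  exact ⟨by simpa [hr] using hR₂, this⟩

/-! ### Verification of the repair phase -/

/-- The invariant of the repair phase, read off from the memory. -/
def RepairState (m L : ℕ) (st E U : ℕ → ℕ) (u μ : ℕ) (σ : State) : Prop :=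
  Frame m L st E σ ∧ σ.arr Arr.quit = U ∧ σ.reg Reg.u = u ∧ u ≤ σ.reg Reg.h + μ ∧
  ((σ.reg Reg.ans = 1 ∧ Repair m (nbr st E) (σ.arr Arr.own) U u (σ.reg Reg.h) ∧
      ∀ a, σ.arr Arr.vis a ≤ σ.reg Reg.h) ∨
    (σ.reg Reg.ans = 0 ∧ u ≤ σ.reg Reg.h ∧ ¬ HasMatching m (nbr st E)))

theorem repairBody_reach (hB : Bounds W m L d st) (hu : u ≤ m) {μ : ℕ} {σ : State}
    (hσ : RepairState m L st E U u μ σ) (hh : σ.reg Reg.h < σ.reg Reg.u) :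
    Reach W repairBody σ (100 * (m * (d + 1))) fun σ' =>
      ∃ μ' < μ, RepairState m L st E U u μ' σ' := by
  obtain ⟨hF, aU, ru, hμ, ⟨rans, hR, avis⟩ | ⟨-, hs, -⟩⟩ := hσ
  swap
  · omega
  rw [ru] at hh
  set h := σ.reg Reg.h with hdef
  have hm := hR.mem h hh
  have hfree := (hR.owned (U h) (by simpa using hm)).2 ⟨h, le_rfl, hh, rfl⟩
  have h3 := hB.m_word
  have hone := hB.one_le_m
  have hmd : m ≤ m * (d + 1) := Nat.le_mul_of_pos_right _ (by omega)
  refine Reach.mono (T := 3 + ((5 + (m * (d + 1) * (30 + 1) + 1)) +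
    (1 + (1 + max (m * (4 + 1) + 1 + 1) 2)))) (Reach.seq
    (R := fun σ₁ => RepairFrame m L st E U u (h + 1) (U h) σ₁ ∧ σ₁.arr Arr.own = σ.arr Arr.own ∧
      ∀ a, σ₁.arr Arr.vis a < h + 1) ?_ fun σ₁ h₁ => Reach.seq
        (search_reach hB hR.matching h₁.1 h₁.2.1 hm hfree h₁.2.2) fun σ₂ h₂ => Reach.seq
          (R := fun σ₃ => σ₃ = σ₂.setReg Reg.tmp 1) (Reach.of_wp ⟨by omega, rfl⟩) ?_)
      ?_ fun _ => id
  · refine Reach.of_wp ?_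
    obtain ⟨rm, rL, ast, aE⟩ := hF
    simp only [Reg.m, Reg.L, Arr.st, Arr.E, Arr.vis, Arr.quit, Reg.ans, Reg.u, Reg.h]
      at rm rL ast aE rans avis aU ru hdef
    simp [RepairFrame, Frame, rm, rL, ast, aE, rans, aU, ru, ← hdef]
    exact ⟨by omega, by omega, fun a => (avis a).trans (by omega), avis⟩
  · rintro σ₃ rfl
    obtain ⟨hRF, hown, hres⟩ := h₂
    have hRF' : RepairFrame m L st E U u (h + 1) (U h) (σ₂.setReg Reg.tmp 1) := by
      simpa [RepairFrame, Frame] using hRF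
    refine Reach.cond (fun hf => ?_) fun hf => ?_
    · simp at hf
      rcases hres with hres | ⟨-, hres⟩
      · simp [hf] at hres
      refine (flip_reach hR hh hRF' (by simpa using hown) (by simpa [Found] using hres)).mono
        (le_max_left _ _) fun σ₄ h₄ => ?_
      obtain ⟨⟨hF₄, hans, hU, hu4, hh4, -, hv4⟩, hR₄⟩ := h₄
      exact ⟨μ - 1, by omega, hF₄, hU, hu4, by omega, .inl ⟨hans, by rwa [hh4], by rwa [hh4]⟩⟩
    · simp at hf
      rcases hres with ⟨-, hres⟩ | hres
      · refine Reach.mono (T := 2) (Reach.of_wp ?_) (le_max_right _ _) fun _ => id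
        simp [RepairFrame, Frame] at hRF
        simp [RepairState, Frame, hRF, hres]
        exact ⟨0, by omega⟩
      · simp [hf] at hres
  · have : max (m * (4 + 1) + 1 + 1) 2 = m * 5 + 2 := by omega
    omega

theorem repair_reach (hB : Bounds W m L d st) (hL : m ≤ L * L) {μ : ℕ} {σ : State}
    (hσ : AuctionState m L d st E μ σ) (hi : m < σ.reg Reg.i) :
    Reach W repair σ (1 + (2 + (L * (100 * (m * (d + 1)) + 1) + 1))) fun σ' =>
      (σ'.reg Reg.ans = 1 ∧ HasMatching m (nbr st E)) ∨
      (σ'.reg Reg.ans = 0 ∧ ¬ HasMatching m (nbr st E)) := by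
  obtain ⟨hF, rans, avis, hA, -⟩ := hσ
  have h3 := hB.m_word
  refine Reach.cond (fun hu => ?_) fun hu => ?_
  · have hu' : σ.reg Reg.u ≤ L := by
      have := hF.2.1
      simp at hu this ⊢
      omega
    refine (Reach.seq (R := RepairState m L st E (σ.arr Arr.quit) (σ.reg Reg.u) (σ.reg Reg.u))
      (Reach.of_wp ?_) fun σ₁ h₁ => (Reach.loop _ _ (fun μ σ h hh => by
        exact repairBody_reach hB hA.quit_le h hh) _ _ h₁).mono le_rfl ?_).mono ?_ fun _ => id
    · have hR := hA.repair hi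
      simp only [Frame, Reg.m, Reg.L, Arr.st, Arr.E, Arr.vis, Arr.own, Arr.quit, Reg.u] at hF avis hR
      simp [RepairState, Frame, hF, avis]
      exact ⟨by omega, hR⟩
    · rintro σ₂ ⟨⟨μ₂, -, -, hu₂, -, ⟨h1, h2, -⟩ | ⟨h1, -, h2⟩⟩, hn⟩
      · refine .inl ⟨h1, h2.hasMatching ?_⟩
        simp at hn hu₂ ⊢
        omega
      · exact .inr ⟨h1, h2⟩
    · exact Nat.add_le_add_left (Nat.add_le_add_right (Nat.mul_le_mul_right _ hu') _) _
  · -- More than `L` vertices gave up, which rules out a matching, as `m ≤ L * L`.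
    refine Reach.mono (T := 1) (Reach.of_wp (p := skip) (.inr ⟨rans, fun hM => ?_⟩)) (by omega)
      fun _ => id
    have h1 := hA.quit_mul_le hM
    have h2 : L < σ.reg Reg.u := by
      have := hF.2.1
      simp at hu this ⊢
      omega
    have h4 := Nat.mul_le_mul_right L h2
    have h5 := hB.one_le_L
    rw [Nat.succ_mul] at h4
    omega

end

section

/-! ### Verification of the construction of the graph -/

variable {W : ℕ}

theorem image_Ico_update (E : ℕ → ℕ) {lo hi : ℕ} (h : lo ≤ hi) (a : ℕ) :
    update E hi a '' Set.Ico lo (hi + 1) = insert a (E '' Set.Ico lo hi) := by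
  rw [← Set.insert_Ico_right_eq_Ico_add_one h, Set.image_insert_eq, update_self]
  congr 1
  exact Set.image_congr fun p hp => update_of_ne hp.2.ne _ _

theorem copies_succ (n k x : ℕ) : copies n (k + 1) x = insert (x + n * k) (copies n k x) := by
  ext a
  simp only [copies, Set.mem_ofPred_eq, Set.mem_insert_iff]
  constructor
  · rintro ⟨j, hj, rfl⟩
    by_cases h : j = k
    · subst h; exact .inl rfl
    · exact .inr ⟨j, by omega, rfl⟩
  · rintro (rfl | ⟨j, hj, rfl⟩)
    · exact ⟨k, by omega, rfl⟩
    · exact ⟨j, by omega, rfl⟩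

/-- What the construction of the graph leaves unchanged. -/
def BuildFrame (inp : ℕ → ℕ) (m n k L : ℕ) (σ : State) : Prop :=
  σ.arr Arr.inp = inp ∧ σ.reg Reg.m = m ∧ σ.reg Reg.n = n ∧ σ.reg Reg.k = k ∧
  σ.reg Reg.kn = n * k ∧ σ.reg Reg.L = L ∧ σ.reg Reg.ans = 0 ∧
  σ.arr Arr.vis = (fun _ => 0) ∧ σ.arr Arr.lev = (fun _ => 0) ∧ σ.arr Arr.own = (fun _ => 0)

/-- The state while the adjacency list of `b` is written: the cells below `lo` contain `E₀`, and
the cells from `lo` on contain the vertices in `S`. -/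
def ListState (E₀ st : ℕ → ℕ) (ptr : ℕ → ℕ) (lo b e : ℕ) (S : Set ℕ) (σ : State) : Prop :=
  σ.arr Arr.st = st ∧ σ.arr Arr.ptr = ptr ∧ σ.reg Reg.b = b ∧ σ.reg Reg.e = e ∧
  (∀ p < lo, σ.arr Arr.E p = E₀ p) ∧ lo ≤ σ.reg Reg.pos ∧
  σ.arr Arr.E '' Set.Ico lo (σ.reg Reg.pos) = S

/-- The inner loop writes the copies `x, x + n, …, x + n * (k - 1)` of the variable `x`. -/
theorem copyLoop_reach {inp E₀ st ptr : ℕ → ℕ} {m n k L lo b e q x pos : ℕ} {S : Set ℕ}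
    (hW : pos + k ≤ W) (hW' : n * k + n ≤ W) (hn : x < n) {σ : State}
    (hF : BuildFrame inp m n k L σ) (hS : ListState E₀ st ptr lo b e S σ)
    (hq : σ.reg Reg.q = q) (hpos : σ.reg Reg.pos = pos) (ha : σ.reg Reg.a = x) (hW1 : 1 ≤ W) :
    Reach W (loop (lt Reg.a Reg.kn) copyBody) σ (k * (4 + 1) + 1) fun σ' =>
      BuildFrame inp m n k L σ' ∧ ListState E₀ st ptr lo b e (S ∪ copies n k x) σ' ∧
      σ'.reg Reg.q = q ∧ σ'.reg Reg.pos = pos + k := by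
  refine (Reach.loop 4 (fun μ σ => BuildFrame inp m n k L σ ∧ σ.reg Reg.q = q ∧
    ∃ j, j + μ = k ∧ σ.reg Reg.a = x + n * j ∧ σ.reg Reg.pos = pos + j ∧
      ListState E₀ st ptr lo b e (S ∪ copies n j x) σ) ?_ k σ
      ⟨hF, hq, 0, by omega, by simpa using ha, by simpa using hpos, ?_⟩).mono le_rfl ?_
  · rintro μ σ ⟨hF, hq, j, hj, ha, hpos, hS⟩ hlt
    refine Reach.of_wp (p := copyBody) ?_
    obtain ⟨s1, s2, s3, s4, s5, s6, s7⟩ := hS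
    simp [BuildFrame] at hF hq ha hpos s1 s2 s3 s4 s5 s6 s7 hlt
    simp [copyBody, BuildFrame, ListState, hF, hq, ha, hpos, s1, s2, s3, s4]
    have hjk : j < k := by
      by_contra hge
      have := Nat.mul_le_mul_left n (Nat.not_lt.1 hge)
      omega
    have := Nat.mul_le_mul_left n hjk.le
    rw [hpos] at s6 s7
    refine ⟨by omega, by omega, by omega, μ - 1, by omega, j + 1, by omega, by ring, by omega, ?_,
      by omega, ?_⟩
    · intro p hp
      rw [update_of_ne (by omega)]
      exact s5 p hp
    · rw [image_Ico_update _ s6, s7, copies_succ, Set.union_insert]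
  · have : copies n 0 x = ∅ := by ext; simp [copies]
    rwa [this, Set.union_empty]
  · rintro σ' ⟨⟨μ, hF, hq, j, hj, ha, hpos, hS⟩, hn'⟩
    have hjk : j = k := by
      have hkn := hF.2.2.2.2.1
      simp at hn' hkn ha
      by_contra hne
      have := Nat.mul_le_mul_left n (show j + 1 ≤ k by omega)
      rw [Nat.mul_add] at this
      omega
    subst hjk
    exact ⟨hF, hS, hq, hpos⟩

/-- The middle loop writes the adjacency list of a clause with the variables `vs`. -/
theorem varLoop_reach {l : List ℕ} {E₀ st ptr : ℕ → ℕ} {m n k L lo b e q pos : ℕ}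
    (vs rest : List ℕ) (hl : l.drop q = vs ++ rest) (hvs : ∀ x ∈ vs, x < n)
    (hW : pos + vs.length * k ≤ W) (hW' : n * k + n ≤ W) (hWe : e ≤ W) (hW1 : 1 ≤ W) {σ : State}
    (hF : BuildFrame (fun i => l.getD i 0) m n k L σ) (hS : ListState E₀ st ptr lo b e ∅ σ)
    (hq : σ.reg Reg.q = q) (he : e = q + vs.length) (hpos : σ.reg Reg.pos = pos) :
    Reach W (loop (lt Reg.q Reg.e) varBody) σ (vs.length * (3 + (k * (4 + 1) + 1) + 1) + 1)
      fun σ' => BuildFrame (fun i => l.getD i 0) m n k L σ' ∧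
        ListState E₀ st ptr lo b e (⋃ x ∈ vs, copies n k x) σ' ∧
        σ'.reg Reg.q = e ∧ l.drop e = rest ∧ σ'.reg Reg.pos = pos + vs.length * k := by
  refine (Reach.loop (3 + (k * (4 + 1) + 1)) (fun μ σ =>
    BuildFrame (fun i => l.getD i 0) m n k L σ ∧ ∃ us ws : List ℕ, us ++ ws = vs ∧ ws.length = μ ∧
      l.drop (σ.reg Reg.q) = ws ++ rest ∧ σ.reg Reg.q + ws.length = e ∧
      σ.reg Reg.pos = pos + us.length * k ∧
      ListState E₀ st ptr lo b e (⋃ x ∈ us, copies n k x) σ) ?_ vs.length σ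
      ⟨hF, [], vs, rfl, rfl, by rwa [hq], by rw [hq, he], by simpa using hpos,
        by simpa using hS⟩).mono
      le_rfl ?_
  · rintro μ σ ⟨hF, us, ws, huw, rfl, hd, hqe, hpos, hS⟩ hlt
    cases ws with
    | nil =>
      have := hS.2.2.2.1
      simp at hlt hqe this
      omega
    | cons x ws =>
      obtain ⟨hx, hd'⟩ := getD_of_drop_eq hd
      have hlen : vs.length = us.length + (ws.length + 1) := by rw [← huw]; simp
      have hmul := Nat.mul_le_mul_right k (show us.length + 1 ≤ vs.length by omega)
      rw [Nat.add_mul] at hmul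
      have hxn : x < n := hvs x (by rw [← huw]; simp)
      refine Reach.seq (R := fun σ₁ => BuildFrame (fun i => l.getD i 0) m n k L σ₁ ∧
        ListState E₀ st ptr lo b e (⋃ x ∈ us, copies n k x) σ₁ ∧ σ₁.reg Reg.q = σ.reg Reg.q + 1 ∧
        σ₁.reg Reg.pos = pos + us.length * k ∧ σ₁.reg Reg.a = x) (Reach.of_wp ?_) fun σ₁ h₁ => ?_
      · obtain ⟨s1, s2, s3, s4, s5, s6, s7⟩ := hS
        have hx' : σ.arr 0 (σ.reg 22) = x := by
          rw [← hx]; exact congrFun hF.1 _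
        simp [BuildFrame] at hF hqe hpos s1 s2 s3 s4 s5 s6 s7
        simp [BuildFrame, ListState, hF, hpos, s1, s2, s3, s4]
        simp [hF] at hx'
        rw [hpos] at s6
        rw [hpos] at s7
        exact ⟨by omega, by omega, ⟨s5, by omega, s7⟩, hx'⟩
      · obtain ⟨hF₁, hS₁, hq₁, hp₁, ha₁⟩ := h₁
        refine (copyLoop_reach (by omega) hW' hxn hF₁ hS₁ hq₁ hp₁ ha₁ hW1).mono le_rfl ?_
        rintro σ₂ ⟨hF₂, hS₂, hq₂, hp₂⟩
        refine ⟨ws.length, by simp, hF₂, us ++ [x], ws, by simpa using huw, rfl, ?_, ?_, ?_, ?_⟩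
        · rw [hq₂]; exact hd'
        · rw [hq₂]; simp at hqe ⊢; omega
        · rw [hp₂]; simp [Nat.add_mul]; omega
        · convert hS₂ using 1
          ext a; simp [or_and_right, exists_or]
  · rintro σ' ⟨⟨μ, hF, us, ws, huw, -, hd, hqe, hpos, hS⟩, hn⟩
    have he' := hS.2.2.2.1
    have hq' : σ'.reg Reg.q = e := by simp at hn hqe he' ⊢; omega
    have hws : ws = [] := List.eq_nil_of_length_eq_zero (by omega)
    subst hws
    rw [List.append_nil] at huw
    subst huw
    exact ⟨hF, hS, hq', by rw [← hq', hd, List.nil_append], hpos⟩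

variable {m s n : ℕ}

/-- The invariant of the construction of the graph, after the adjacency lists of the clauses before
clause `i + 1 = b` have been written. The function `st` extends the array by the start of the list
that comes next. -/
def BuildState (f : PiSigma m s n) (c k L μ : ℕ) (σ : State) : Prop :=
  BuildFrame (fun i => (f.encode c).getD i 0) m n k L σ ∧
  ∃ i, i + μ = m ∧ σ.reg Reg.b = i + 1 ∧ (f.encode c).drop (σ.reg Reg.q) = f.blocksFrom i ∧
    σ.reg Reg.q ≤ 3 + i * (s + 1) ∧ σ.reg Reg.pos ≤ i * (s * k) ∧
    ∃ st : ℕ → ℕ, st (i + 1) = σ.reg Reg.pos ∧ (∀ b, 1 ≤ b → b ≤ i →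
      σ.arr Arr.st b = st b ∧ σ.arr Arr.ptr b = st b ∧ st b ≤ st (b + 1) ∧
      st (b + 1) ≤ st b + s * k ∧ st (b + 1) ≤ σ.reg Reg.pos) ∧
    ∀ (b : Fin m), (b : ℕ) < i → σ.arr Arr.E '' Set.Ico (st (b + 1)) (st (b + 2))
      = ⋃ x ∈ f.clause b, copies n k x

theorem clauseBody_reach (f : PiSigma m s n) {c k L μ : ℕ} (hW : 3 + m * (s + 1) ≤ W)
    (hW₂ : m * (s * k) ≤ W) (hW' : n * k + n ≤ W) {σ : State}
    (hσ : BuildState f c k L μ σ) (hb : σ.reg Reg.b ≤ σ.reg Reg.m) :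
    Reach W clauseBody σ (6 + ((s * (3 + (k * (4 + 1) + 1) + 1) + 1) + 2)) fun σ' =>
      ∃ μ' < μ, BuildState f c k L μ' σ' := by
  obtain ⟨hF, i, hi, hbi, hd, hq, hp, st, hst, hall, hnb⟩ := hσ
  have him : i < m := by have := hF.2.1; simp at hb this hbi; omega
  have hlen := f.length_le ⟨i, him⟩
  set cl := f.clause ⟨i, him⟩ with hcl
  rw [f.blocksFrom_eq ⟨i, him⟩] at hd
  obtain ⟨hr, hd'⟩ := getD_of_drop_eq hd
  rw [← hcl] at hr hd'
  obtain ⟨vs, hvs⟩ : ∃ vs, vs = cl.map (fun x : Fin n => (x : ℕ)) := ⟨_, rfl⟩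
  have hvl : cl.length = vs.length := by simp [hvs]
  have hvn : ∀ x ∈ vs, x < n := by simp [hvs]
  have hvc : ⋃ x ∈ vs, copies n k x = ⋃ x ∈ cl, copies n k x := by ext a; simp [hvs]
  rw [← hvs] at hd'
  rw [hvl] at hr hlen
  have hmul := Nat.mul_le_mul_right (s + 1) (show i + 1 ≤ m by omega)
  have hmul₂ := Nat.mul_le_mul_right (s * k) (show i + 1 ≤ m by omega)
  have hmul₃ := Nat.mul_le_mul_right k hlen
  rw [Nat.add_mul] at hmul hmul₂
  refine Reach.mono (T := 6 + ((vs.length * (3 + (k * (4 + 1) + 1) + 1) + 1) + 2))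
    (Reach.seq (R := fun σ₁ => BuildFrame (fun i => (f.encode c).getD i 0) m n k L σ₁ ∧
      ListState (σ.arr Arr.E) (update (σ.arr Arr.st) (i + 1) (σ.reg Reg.pos))
        (update (σ.arr Arr.ptr) (i + 1) (σ.reg Reg.pos)) (σ.reg Reg.pos) (i + 1)
        (σ.reg Reg.q + 1 + vs.length) ∅ σ₁ ∧ σ₁.reg Reg.q = σ.reg Reg.q + 1 ∧
        σ₁.reg Reg.pos = σ.reg Reg.pos) (Reach.of_wp ?_) fun σ₁ h₁ => Reach.seq
      (varLoop_reach vs _ hd' hvn (by omega) hW' (by omega) (by omega) h₁.1 h₁.2.1 h₁.2.2.1 rfl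
        h₁.2.2.2) fun σ₂ h₂ => Reach.of_wp
          (p := inc Reg.b) ?_) ?_ fun _ => id
  · have hr' : σ.arr 0 (σ.reg 22) = vs.length := by
      rw [← hr]; exact congrFun hF.1 _
    simp [BuildFrame] at hF hbi hq hp hst hr'
    simp [BuildFrame, ListState, hF, hbi]
    simp [hF] at hr'
    rw [hr']
    exact ⟨by omega, by omega, by omega, by omega⟩
  · obtain ⟨hF₂, ⟨s1, s2, s3, s4, s5, s6, s7⟩, hq₂, hd₂, hp₂⟩ := h₂
    have hp₂' : σ₂.reg Reg.pos ≤ (i + 1) * (s * k) := by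
      rw [hp₂, Nat.add_mul]; simp at hp ⊢; omega
    have hE : ∀ lo hi, hi ≤ σ.reg Reg.pos →
        σ₂.arr Arr.E '' Set.Ico lo hi = σ.arr Arr.E '' Set.Ico lo hi := fun lo hi h =>
      Set.image_congr fun p hp => s5 p (hp.2.trans_le h)
    have hmono : ∀ b, 1 ≤ b → b ≤ i + 1 → st b ≤ σ.reg Reg.pos := by
      intro b h1 h2
      rcases Nat.lt_or_ge i b with h | h
      · rw [← hst, show b = i + 1 by omega]
      · have := hall b h1 h; omega
    simp only [inc, wp]
    refine ⟨by omega, ?_, μ - 1, by omega, by simpa [BuildFrame] using hF₂, i + 1, by omega, ?_⟩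
    · simp at s3 ⊢; rw [s3]; nlinarith
    · simp at s1 s2 s3 s4 s6 s7 hq₂ hp₂ hp₂' hd₂ hq hbi hE hnb hall hst hmono ⊢
      rw [s1, s2, s3, hq₂]
      refine ⟨rfl, hd₂, by rw [Nat.add_mul]; omega, hp₂',
        update st (i + 2) (σ₂.reg 23), by simp, ?_, ?_⟩
      · intro b h1 h2
        by_cases hb' : b = i + 1
        · subst hb'
          simp [hst]
          omega
        · have := hall b h1 (by omega)
          rw [update_of_ne hb', update_of_ne hb', update_of_ne (by omega), update_of_ne (by omega)]
          refine ⟨this.1, this.2.1, this.2.2.1, this.2.2.2.1, ?_⟩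
          omega
      · intro b hb'
        rw [update_of_ne (by omega)]
        by_cases hbi' : (b : ℕ) = i
        · have : b = ⟨i, him⟩ := Fin.ext hbi'
          subst this
          simp only [update_self, hst, s7]
          rw [hvc]
        · rw [update_of_ne (by omega), hE _ _ (hmono _ (by omega) (by omega))]
          exact hnb b (by omega)
  · have := Nat.mul_le_mul_right (3 + (k * (4 + 1) + 1) + 1) hlen
    omega

end

section

variable {W m s n : ℕ}

theorem build_reach (f : PiSigma m s n) {c k L : ℕ} (hm : 1 ≤ m) (hL : 1 ≤ L)
    (hW : 3 + m * (s + 1) ≤ W) (hW₂ : m * (s * k) ≤ W) (hW' : n * k + n ≤ W) (hWm : m + 2 ≤ W)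
    (hWL : L + 1 ≤ W) {σ : State} (hF : BuildFrame (fun i => (f.encode c).getD i 0) m n k L σ) :
    Reach W build σ
      (3 + ((m * (6 + ((s * (3 + (k * (4 + 1) + 1) + 1) + 1) + 2) + 1) + 1) + 1)) fun σ' =>
      ∃ st E, GraphState m L st E σ' ∧ Bounds W m L (s * k) st ∧
        ∀ i : Fin m, nbr st E (i + 1) = ⋃ x ∈ f.clause i, copies n k x := by
  refine Reach.seq (R := BuildState f c k L m) (Reach.of_wp ?_) fun σ₁ h₁ => Reach.seq
    (Reach.loop _ _ (fun μ σ h hb => by exact clauseBody_reach f hW hW₂ hW' h hb) _ _ h₁)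
    fun σ₂ h₂ => Reach.of_wp ?_
  · simp [BuildFrame] at hF
    simp [BuildState, BuildFrame, hF, f.encode_eq]
    exact ⟨by omega, by omega, fun _ => 0, rfl, by grind⟩
  · obtain ⟨⟨μ, hF, i, hi, hbi, -, -, hp, st, hst, hall, hnb⟩, hn⟩ := h₂
    have him : i = m := by have := hF.2.1; simp at hn hbi this; omega
    subst him
    simp [BuildFrame] at hF hbi hp hst hall hnb
    have hst' : ∀ b, 1 ≤ b → b ≤ i + 1 → update (σ₂.arr 1) (i + 1) (σ₂.reg 23) b = st b := by
      intro b h1 h2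
      by_cases hb : b = i + 1
      · subst hb; simp [hst]
      · rw [update_of_ne hb]; exact (hall b h1 (by omega)).1
    refine ⟨update (σ₂.arr 1) (i + 1) (σ₂.reg 23), σ₂.arr Arr.E, ?_, ?_, ?_⟩
    · simp [GraphState, Frame, hF, hbi]
      intro b h1 h2
      have := hst' b h1 (by omega)
      rw [this]
      exact (hall b h1 h2).2.1
    · refine ⟨hm, hL, ?_, ?_, ?_, hWm, hWL⟩ <;> intro b hb <;> rw [Finset.mem_Icc] at hb <;>
        have := hall b hb.1 hb.2 <;> simp only [hst' b hb.1 (by omega),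
          hst' (b + 1) (by omega) (by omega)] <;> omega
    · intro b
      rw [nbr, hst' _ (by omega) (by omega), hst' _ (by omega) (by omega)]
      exact hnb b

/-! ### Verification of the computation of the parameters -/

theorem readParams_reach (f : PiSigma m s n) {c : ℕ} (hW : 2 ≤ W) :
    Reach W readParams (initState (f.encode c)) 7 fun σ =>
      σ.arr = (initState (f.encode c)).arr ∧ σ.reg Reg.ans = 0 ∧ σ.reg Reg.m = m ∧
      σ.reg Reg.n = n ∧ σ.reg Reg.k = c - 1 := by
  refine Reach.of_wp (p := readParams) ?_
  simp [readParams, initState, f.encode_eq]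
  omega

theorem mulParams_reach {A : ℕ → ℕ → ℕ} {k : ℕ} (hW : n * k ≤ W) (hWk : k ≤ W) (hW1 : 1 ≤ W)
    {σ : State} (hσ : σ.arr = A ∧ σ.reg Reg.ans = 0 ∧ σ.reg Reg.m = m ∧ σ.reg Reg.n = n ∧
      σ.reg Reg.k = k) :
    Reach W mulParams σ (2 + (k * (3 + 1) + 1)) fun σ =>
      σ.arr = A ∧ σ.reg Reg.ans = 0 ∧ σ.reg Reg.m = m ∧ σ.reg Reg.n = n ∧ σ.reg Reg.k = k ∧
      σ.reg Reg.kn = n * k := by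
  refine Reach.seq (R := fun σ => (σ.arr = A ∧ σ.reg Reg.ans = 0 ∧ σ.reg Reg.m = m ∧
    σ.reg Reg.n = n ∧ σ.reg Reg.k = k) ∧ σ.reg Reg.j + k = k ∧ σ.reg Reg.kn = n * σ.reg Reg.j)
    (Reach.of_wp ?_) fun σ₁ h₁ => (Reach.loop 3 (fun μ σ => (σ.arr = A ∧ σ.reg Reg.ans = 0 ∧
      σ.reg Reg.m = m ∧ σ.reg Reg.n = n ∧ σ.reg Reg.k = k) ∧ σ.reg Reg.j + μ = k ∧
      σ.reg Reg.kn = n * σ.reg Reg.j) ?_ k σ₁ h₁).mono le_rfl ?_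
  · simp at hσ
    simp [hσ]
  · rintro μ σ ⟨hσ, hj, hkn⟩ hlt
    refine Reach.of_wp (p := add Reg.kn Reg.kn Reg.n ;; inc Reg.j) ?_
    simp at hσ hj hkn hlt
    have := Nat.mul_le_mul_left n (show σ.reg 25 + 1 ≤ k by omega)
    rw [Nat.mul_add] at this
    simp [hσ, hkn]
    exact ⟨by omega, by omega, by omega, μ - 1, by omega, by omega, by ring⟩
  · rintro σ ⟨⟨μ, h, hj, hkn⟩, hn⟩
    refine ⟨h.1, h.2.1, h.2.2.1, h.2.2.2.1, h.2.2.2.2, ?_⟩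
    have h5 := h.2.2.2.2
    simp at hn hj hkn h5 ⊢
    rw [hkn, show σ.reg 25 = k by omega]

theorem sqrtParam_reach {A : ℕ → ℕ → ℕ} {k : ℕ} (hW : 3 * m + 1 ≤ W)
    {σ : State} (hσ : σ.arr = A ∧ σ.reg Reg.ans = 0 ∧ σ.reg Reg.m = m ∧ σ.reg Reg.n = n ∧
      σ.reg Reg.k = k ∧ σ.reg Reg.kn = n * k) :
    Reach W sqrtParam σ (2 + (m * (6 + 1) + 1)) fun σ =>
      σ.arr = A ∧ σ.reg Reg.ans = 0 ∧ σ.reg Reg.m = m ∧ σ.reg Reg.n = n ∧ σ.reg Reg.k = k ∧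
      σ.reg Reg.kn = n * k ∧ m ≤ σ.reg Reg.L * σ.reg Reg.L ∧
      ∀ l < σ.reg Reg.L, l * l < m := by
  refine Reach.seq (R := fun σ => (σ.arr = A ∧ σ.reg Reg.ans = 0 ∧ σ.reg Reg.m = m ∧
    σ.reg Reg.n = n ∧ σ.reg Reg.k = k ∧ σ.reg Reg.kn = n * k) ∧
    σ.reg Reg.sq = σ.reg Reg.L * σ.reg Reg.L ∧ m ≤ σ.reg Reg.sq + m ∧
    ∀ l < σ.reg Reg.L, l * l < m)
    (Reach.of_wp ?_) fun σ₁ h₁ => (Reach.loop 6 (fun μ σ => (σ.arr = A ∧ σ.reg Reg.ans = 0 ∧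
      σ.reg Reg.m = m ∧ σ.reg Reg.n = n ∧ σ.reg Reg.k = k ∧ σ.reg Reg.kn = n * k) ∧
      σ.reg Reg.sq = σ.reg Reg.L * σ.reg Reg.L ∧ m ≤ σ.reg Reg.sq + μ ∧
      ∀ l < σ.reg Reg.L, l * l < m) ?_ m σ₁ h₁).mono le_rfl ?_
  · simp at hσ
    simp [hσ]
  · rintro μ σ ⟨hσ, hsq, hμ, hl⟩ hlt
    refine Reach.of_wp (p := add Reg.sq Reg.sq Reg.L ;; add Reg.sq Reg.sq Reg.L ;; inc Reg.sq ;;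
      inc Reg.L) ?_
    simp at hσ hsq hμ hl hlt
    have hle : σ.reg 5 ≤ σ.reg 5 * σ.reg 5 := Nat.le_mul_self _
    have hm : σ.reg 5 * σ.reg 5 < m := by omega
    simp [hσ, hsq]
    refine ⟨by omega, by omega, by omega, by omega, by omega, by omega, μ - 1, by omega, by ring,
      by omega, fun l hl' => ?_⟩
    rcases Nat.le_iff_lt_or_eq.mp hl' with h | rfl
    · exact hl l h
    · exact hm
  · rintro σ ⟨⟨μ, h, hsq, -, hl⟩, hn⟩
    refine ⟨h.1, h.2.1, h.2.2.1, h.2.2.2.1, h.2.2.2.2.1, h.2.2.2.2.2, ?_, hl⟩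
    have h3 := h.2.2.1
    simp at hn hsq h3 ⊢
    omega

/-! ### The running time -/

/-- The number of steps of the test: the terms belong to the six phases in turn, with `k = c - 1`
copies of each variable and lists of length at most `s * k`. -/
def testTime (m s k L : ℕ) : ℕ :=
  7 + ((2 + (k * (3 + 1) + 1)) + ((2 + (m * (6 + 1) + 1)) +
    ((3 + ((m * (6 + ((s * (3 + (k * (4 + 1) + 1) + 1) + 1) + 2) + 1) + 1) + 1)) +
    ((3 + (m * ((L + 1) * (s * k + 1)) * (30 + 1) + 1)) +
    (1 + (2 + (L * (100 * (m * (s * k + 1)) + 1) + 1)))))))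

theorem cMonomialTest_reach (f : PiSigma m s n) {c k L : ℕ} (hc : c = k + 1) (hm : 1 ≤ m)
    (hW : 3 * m + 5 + m * (s + 1) ≤ W) (hW₂ : m * (s * k) ≤ W) (hW' : n * k + n ≤ W) (hWk : k ≤ W)
    (hL : m ≤ L * L) (hL' : ∀ l < L, l * l < m) :
    Reach W cMonomialTest (initState (f.encode c)) (testTime m s k L) fun σ =>
      (f.HasCMonomial c ∧ σ.reg Reg.ans = 1) ∨ (¬ f.HasCMonomial c ∧ σ.reg Reg.ans = 0) := by
  have hL1 : 1 ≤ L := Nat.pos_of_ne_zero (by rintro rfl; omega)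
  have hLm : L ≤ m := by
    have := hL' (L - 1) (by omega)
    have := Nat.le_mul_self (L - 1)
    omega
  refine Reach.seq (readParams_reach f (by omega)) fun σ₁ h₁ => Reach.seq (mulParams_reach (n := n)
    (k := k) (by omega) hWk (by omega) (by simpa [hc] using h₁)) fun σ₂ h₂ => Reach.seq
    (sqrtParam_reach (by omega) h₂) fun σ₃ h₃ => ?_
  obtain ⟨harr, hans, hm₃, hn₃, hk₃, hkn₃, hL₃, hL₃'⟩ := h₃
  have hLL : σ₃.reg Reg.L = L := by
    rcases lt_trichotomy (σ₃.reg Reg.L) L with h | h | h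
    · have := hL' _ h; omega
    · exact h
    · have := hL₃' _ h; omega
  have hF : BuildFrame (fun i => (f.encode c).getD i 0) m n k L σ₃ :=
    ⟨by rw [harr, ← hc]; rfl, hm₃, hn₃, hk₃, hkn₃, hLL, hans, by rw [harr]; rfl, by rw [harr]; rfl,
      by rw [harr]; rfl⟩
  refine Reach.seq (build_reach f hm hL1 (by omega) hW₂ hW' (by omega) (by omega) hF)
    fun σ₄ ⟨st, E, hG, hB, hN⟩ => Reach.seq (auction_reach hB hG) fun σ₅ ⟨μ, hA, hi⟩ =>
      (repair_reach hB hL hA hi).mono le_rfl fun σ₆ h₆ => ?_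
  have hiff := f.hasCMonomial_iff (c := c) (by omega) (N := nbr st E)
    (by rw [hc]; exact hN)
  rw [hiff]
  rcases h₆ with h | h
  · exact .inl ⟨h.2, h.1⟩
  · exact .inr ⟨h.2, h.1⟩

theorem testTime_le {m s k L : ℕ} (hm : 1 ≤ m) (hs : 1 ≤ s) (hL : 1 ≤ L) :
    testTime m s k L ≤ 400 * ((k + 1) * m * s * L) := by
  set X := (k + 1) * m * s * L with hX
  have e : X = m * (s * (k + 1) * L) := by rw [hX]; ring
  have h0 : s * k + 1 ≤ s * (k + 1) := by rw [Nat.mul_add]; omega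
  have h1 : L * (m * (s * k + 1)) ≤ X :=
    (Nat.mul_le_mul_left L (Nat.mul_le_mul_left m h0)).trans_eq (by rw [hX]; ring)
  have h2 : m * ((L + 1) * (s * k + 1)) ≤ 2 * X :=
    (Nat.mul_le_mul_left m (Nat.mul_le_mul (show L + 1 ≤ 2 * L by omega) h0)).trans_eq
      (by rw [hX]; ring)
  have h3 : m * (s * (k + 1)) ≤ X := by
    rw [e]; exact Nat.mul_le_mul_left m (Nat.le_mul_of_pos_right _ hL)
  have h4 : s * (k + 1) ≤ X := (Nat.le_mul_of_pos_left _ hm).trans h3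
  have h5 : k + 1 ≤ X := (Nat.le_mul_of_pos_left _ hs).trans h4
  have h6 : m ≤ X := (Nat.le_mul_of_pos_right _ (by positivity)).trans h3
  have h7 : L ≤ X := (Nat.le_mul_of_pos_right _ (by positivity)).trans h1
  have h8 : m * s ≤ X := by
    refine le_trans ?_ h3
    rw [← Nat.mul_assoc]
    exact Nat.le_mul_of_pos_right _ (by omega)
  have h9 : testTime m s k L = 26 + 4 * k + 17 * m + 5 * (m * (s * (k + 1)))
      + 31 * (m * ((L + 1) * (s * k + 1))) + 100 * (L * (m * (s * k + 1))) + L := by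
    rw [testTime]; ring
  omega

end

end MonomialTesting

theorem mainTheorem6 :
    ∃ (P : MonomialTesting.Prog) (K : ℕ),
      ∀ c m s n : ℕ, 2 < c → 1 ≤ m → 1 ≤ s → ∀ f : MonomialTesting.PiSigma m s n,
        ∃ (σ : MonomialTesting.State) (t : ℕ),
          MonomialTesting.Exec (K * (c + m + s + n) ^ K) P
            (MonomialTesting.initState (f.encode c)) σ t ∧
          (t : ℝ) ≤ (K : ℝ) * ((c : ℝ) * (m : ℝ) * (s : ℝ) * √((m : ℝ) + (c : ℝ) * (n : ℝ))) ∧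
          (f.HasCMonomial c → σ.reg 0 = 1) ∧
          (¬ f.HasCMonomial c → σ.reg 0 = 0) := by
  -- The factor `400` of `testTime_le` is doubled by `L ≤ 2 * √m`.
  refine ⟨MonomialTesting.cMonomialTest, 800, fun c m s n hc hm hs f => ?_⟩
  obtain ⟨k, rfl⟩ : ∃ k, c = k + 1 := ⟨c - 1, by omega⟩
  have hex : ∃ L, m ≤ L * L := ⟨m, Nat.le_mul_self m⟩
  obtain ⟨L, hL, hL'⟩ : ∃ L, m ≤ L * L ∧ ∀ l < L, l * l < m := by
    classical
    exact ⟨Nat.find hex, Nat.find_spec hex, fun l hl => not_le.1 (Nat.find_min hex hl)⟩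
  have hL1 : 1 ≤ L := Nat.pos_of_ne_zero (by rintro rfl; omega)
  set M := k + 1 + m + s + n with hM
  have hM1 : 1 ≤ M := by omega
  have hM2 : M ≤ M * M := Nat.le_mul_self M
  have hM3 : M * M ≤ M * (M * M) := Nat.le_mul_of_pos_left _ hM1
  have hpow : ∀ K, 3 ≤ K → 800 * (M * (M * M)) ≤ 800 * M ^ K := fun K hK => by
    refine Nat.mul_le_mul_left _ ?_
    calc M * (M * M) = M ^ 3 := by ring
      _ ≤ M ^ K := Nat.pow_le_pow_right hM1 hK
  have hW := hpow 800 (by norm_num)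
  generalize 800 * M ^ 800 = W at hW ⊢
  have h1 : m * (s + 1) ≤ M * M := Nat.mul_le_mul (by omega) (by omega)
  have h2 : m * (s * k) ≤ M * (M * M) :=
    Nat.mul_le_mul (by omega) (Nat.mul_le_mul (by omega) (by omega))
  have h3 : n * k ≤ M * M := Nat.mul_le_mul (by omega) (by omega)
  obtain ⟨σ, t, hexec, ht, hσ⟩ := MonomialTesting.cMonomialTest_reach (W := W) (k := k) f rfl hm
    (by omega) (by omega) (by omega) (by omega) hL hL'
  refine ⟨σ, t, hexec, ?_, ?_, ?_⟩
  · have h4 := ht.trans (MonomialTesting.testTime_le (k := k) hm hs hL1)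
    have hm' : (1 : ℝ) ≤ m := by exact_mod_cast hm
    have hsq : (1 : ℝ) ≤ √m := Real.one_le_sqrt.2 hm'
    -- As `L` is least, `(L - 1) ^ 2 < m`.
    have h5 : (L : ℝ) ≤ 2 * √m := by
      have h6 : ((L - 1 : ℕ) : ℝ) ≤ √m := by
        refine Real.le_sqrt_of_sq_le ?_
        have := hL' (L - 1) (by omega)
        rw [sq]
        exact_mod_cast this.le
      rw [Nat.cast_sub hL1] at h6
      push_cast at h6
      linarith
    have h7 : √(m : ℝ) ≤ √((m : ℝ) + ((k + 1 : ℕ) : ℝ) * n) :=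
      Real.sqrt_le_sqrt (by nlinarith [show (0 : ℝ) ≤ ((k + 1 : ℕ) : ℝ) * n by positivity])
    calc (t : ℝ) ≤ ((400 * ((k + 1) * m * s * L) : ℕ) : ℝ) := by exact_mod_cast h4
      _ = 400 * (((k + 1 : ℕ) : ℝ) * m * s) * L := by push_cast; ring
      _ ≤ 400 * (((k + 1 : ℕ) : ℝ) * m * s) * (2 * √((m : ℝ) + ((k + 1 : ℕ) : ℝ) * n)) := by
        gcongr
        linarith
      _ = _ := by push_cast; ring
  · rintro h
    rcases hσ with hσ | hσ
    · exact hσ.2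
    · exact (hσ.1 h).elim
  · rintro h
    rcases hσ with hσ | hσ
    · exact (h hσ.1).elim
    · exact hσ.2
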